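/- **Graphs and paths.** An unlabeled graph $(N,E,\eta)$ consists of a finite set $N$ of node identifiers, a finite set $E$ of edge identifiers and a map $\eta\colon E\to N\times N$; a graph database $G$ additionally labels its edges. A path is a sequence $\rho=v_0e_1v_1\cdots e_nv_n$ with $n\ge 0$ and $\eta(e_i)=(v_{i-1},v_i)$ for all $i$; $\mathrm{src}(\rho)=v_0$, $\mathrm{tgt}(\rho)=v_n$, and its size is $2n+1$. **PMRs.** A path multiset representation (PMR) over $G$ is a tuple $R=(N,E,\eta,\gamma,S,T)$, where $(N,E,\eta)$ is an unlabeled graph, $\gamma$ is a homomorphism from it to $G$ (mapping nodes to nodes and edges to edges), and $S,T\subseteq N$. Let $\mathrm{mpaths}(R)$ be the multiset $\{\!\{\gamma(\pi)\mid \pi$ a path in $R$ from a node of $S$ to a node of $T\}\!\}$. $R$ is a PMR of $M$ if $M=\mathrm{mpaths}(R)$, and $R$ is trim if each of its nodes lies on some path from $S$ to $T$. A grouped PMR is a finite set $\{R_1,\dots,R_k\}$ of PMRs over $G$ such that $\mathrm{mpaths}(R_i)$ and $\mathrm{mpaths}(R_j)$ have no common element for $i\ne j$; it represents $\{\mathrm{mpaths}(R_1),\dots,\mathrm{mpaths}(R_k)\}$,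 and it is trim if every $R_i$ is. **Groups and tables.** For a finite path multiset $M$ on $G$ and a non-empty $K\subseteq\{\mathrm{src},\mathrm{tgt}\}$, $\mathrm{group}_K(M)$ is the set whose elements are, for each $\rho\in M$, the multiset of all paths in $M$ (with their multiplicities) that agree with $\rho$ on every endpoint in $K$. Let $\mathrm{tab}(M)=\{\!\{(\mathrm{src}(\rho),\mathrm{tgt}(\rho),\rho)\mid\rho\in M\}\!\}$, and let $\mathrm{tab}(\mathrm{group}_K(M))$ be the set of the tuples that consist of the endpoint(s) in $K$ shared by all paths of $M'$ (source first), followed by $M'$, for $M'\in\mathrm{group}_K(M)$. The size of a group is the sum of the sizes of its paths, with multiplicity; the size of a tuple adds $1$ for each endpoint listed. **Computation.** Algorithms are programs of a random access machine in which identifiers and integers take one memory cell, and each addition, subtraction, comparison with zero, memory access and output of a cell or of a separator takes one time step. The input, a PMR, is in read-only memory in adjacency-list representation: one can access in constant time, by index, the entries of the list of source nodes and of the list of outgoing edges of a given node, the lengths of these lists, the endpoints of an edge, the value of $\gamma$ at a node or edge, and whether a node belongs to $T$. A grouped PMR is an array of pointers to such representations. A program enumerates a finite multiset $O$ with output-linear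 delay if there is a constant $c$, independent of the input and of $O$, such that on every admissible input it outputs the elements of $O$ one by one, as $o_1,\dots,o_k$ in some order and each as often as its multiplicity in $O$; the time between finishing the output of $o_{i-1}$ (or the start, if $i=1$) and finishing the output of $o_i$ is at most $c$ times the size of $o_i$; and it halts at most $c$ steps after finishing $o_k$ (after the start, if $k=0$). **Proposition.** Let $M$ be a finite path multiset on a graph database $G$. 1. From a trim PMR $R$ of $M$ one can enumerate both $M$ and $\mathrm{tab}(M)$ with output-linear delay. 2. For any non-empty $K\subseteq\{\mathrm{src},\mathrm{tgt}\}$, from a trim grouped PMR of $\mathrm{group}_K(M)$ one can enumerate both $\mathrm{group}_K(M)$ and $\mathrm{tab}(\mathrm{group}_K(M))$ with output-linear delay. (In each of these enumeration tasks, the program and the constant $c$ are independent of $G$, $M$, $R$ and of the way $R$ is stored.) -/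

import Mathlib

open scoped Classical in
/-- The indicator of a proposition, as a word of memory. -/
noncomputable def flag (p : Prop) : ℕ := if p then 1 else 0

/-! ## Graph databases and paths -/

/-- Node identifiers: an infinite set. An identifier fits in one word of the RAM below,
hence it is a natural number. -/
structure NodeId where
  code : ℕ

/-- Edge identifiers, an infinite set disjoint from the node identifiers. -/
structure EdgeId where
  code : ℕ

/-- Edge labels. -/
structure Label where
  code : ℕ

/-- An unlabeled graph: a finite directed multigraph with incidence mapping `η`. -/
structure UGraph where
  N : Finset NodeId
  E : Finset EdgeId
  η : E → N × N

/-- A graph database `(N, E, η, lab)`. -/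
structure GraphDB extends UGraph where
  lab : E → Label

/-- `IsWalk g v₀ [(e₁, v₁), …, (eₙ, vₙ)]`: `η eᵢ = (vᵢ₋₁, vᵢ)` for all `i`. -/
def UGraph.IsWalk (g : UGraph) : g.N → List (g.E × g.N) → Prop
  | _, [] => True
  | u, (e, v) :: s => g.η e = (u, v) ∧ UGraph.IsWalk g v s

/-- A path `v₀ e₁ v₁ e₂ v₂ ⋯ eₙ vₙ` with `n ≥ 0`: its first node and the list of
the pairs `(eᵢ, vᵢ)`. -/
@[ext]
structure UGraph.Path (g : UGraph) where
  start : g.N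
  steps : List (g.E × g.N)
  isWalk : g.IsWalk start steps

namespace UGraph.Path

variable {g : UGraph}

/-- The nodes `v₀, …, vₙ` of a path. -/
def nodes (ρ : g.Path) : List g.N := ρ.start :: ρ.steps.map Prod.snd

def src (ρ : g.Path) : g.N := ρ.start

def tgt (ρ : g.Path) : g.N := ρ.nodes.getLast (List.cons_ne_nil _ _)

/-- The size of a path: its number of node and edge occurrences. -/
def size (ρ : g.Path) : ℕ := 2 * ρ.steps.length + 1

/-- The path is from `S` to `T`. -/
def FromTo (ρ : g.Path) (S T : Set g.N) : Prop := ρ.src ∈ S ∧ ρ.tgt ∈ T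

end UGraph.Path

/-! ## Path multiset representations -/

/-- A path multiset representation (PMR) `(N, E, η, γ, S, T)` over the graph `G`;
`γ` is given by its restrictions `γN` to nodes and `γE` to edges. -/
structure PMR (G : GraphDB) extends UGraph where
  γN : N → G.N
  γE : E → G.E
  hom : ∀ e, G.η (γE e) = (γN (η e).1, γN (η e).2)
  S : Set N
  T : Set N

namespace PMR

variable {G : GraphDB}

theorem isWalk_map (R : PMR G) : ∀ (u : R.N) (s : List (R.E × R.N)), R.toUGraph.IsWalk u s →
    G.toUGraph.IsWalk (R.γN u) (s.map (Prod.map R.γE R.γN))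
  | _, [], _ => trivial
  | u, (e, v) :: s, h => by
    refine ⟨?_, isWalk_map R v s h.2⟩
    have h1 := R.hom e
    rw [h.1] at h1
    exact h1

/-- The path `γ(π)` of `G` represented by the path `π` of `R`. -/
def mapPath (R : PMR G) (π : R.toUGraph.Path) : G.toUGraph.Path where
  start := R.γN π.start
  steps := π.steps.map (Prod.map R.γE R.γN)
  isWalk := R.isWalk_map _ _ π.isWalk

/-- The multiset (with multiplicities in `ℕ ∪ {∞}`) of the paths `γ(π)`, where `π` ranges over
the paths from `S` to `T` in `R`. -/
noncomputable def mpaths (R : PMR G) : G.toUGraph.Path → ℕ∞ :=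
  fun ρ => {π : R.toUGraph.Path | π.FromTo R.S R.T ∧ R.mapPath π = ρ}.encard

/-- Every node is on some path from `S` to `T`. -/
def Trim (R : PMR G) : Prop :=
  ∀ u : R.N, ∃ π : R.toUGraph.Path, π.FromTo R.S R.T ∧ u ∈ π.nodes

end PMR

open scoped Classical in
/-- A finite multiset as a multiset with multiplicities in `ℕ ∪ {∞}`. -/
noncomputable def Multiset.mult {α : Type*} (M : Multiset α) : α → ℕ∞ := fun a => (M.count a : ℕ∞)

/-- `R` represents the finite path multiset `M`. -/
def PMR.Represents {G : GraphDB} (R : PMR G) (M : Multiset G.toUGraph.Path) : Prop :=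
  R.mpaths = M.mult

/-! ## Grouping and tables -/

/-- The two keys by which paths can be grouped. -/
inductive Endpoint where
  | src
  | tgt

section Grouping

variable {G : GraphDB}

open scoped Classical in
/-- The selection `σ_{U,V}(M)` of the paths of `M` from `U` to `V`. -/
noncomputable def sel (U V : Set G.N) (M : Multiset G.toUGraph.Path) :
    Multiset G.toUGraph.Path :=
  M.filter fun ρ => ρ.FromTo U V

open scoped Classical in
/-- The grouped path multiset `group_K(M)`, a set of path multisets, for `K ⊆ {src, tgt}`. -/
noncomputable def group (K : Set Endpoint) (M : Multiset G.toUGraph.Path) :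
    Finset (Multiset G.toUGraph.Path) :=
  M.toFinset.image fun ρ =>
    sel (if Endpoint.src ∈ K then {ρ.src} else Set.univ)
      (if Endpoint.tgt ∈ K then {ρ.tgt} else Set.univ) M

/-- The table `tab(M)`. -/
def tab (M : Multiset G.toUGraph.Path) : Multiset (G.N × G.N × G.toUGraph.Path) :=
  M.map fun ρ => (ρ.src, ρ.tgt, ρ)

open scoped Classical in
/-- The endpoints of a path that are selected by `K`, source first. -/
noncomputable def key (K : Set Endpoint) (ρ : G.toUGraph.Path) : List G.N :=
  (if Endpoint.src ∈ K then [ρ.src] else []) ++ (if Endpoint.tgt ∈ K then [ρ.tgt] else [])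

open scoped Classical in
/-- The table `tab(H)` of a `K`-grouped path multiset `H`: all tuples that consist of
the `K`-endpoints shared by the paths of a group `M'`, and of `M'` itself. -/
noncomputable def groupTab (K : Set Endpoint) (H : Finset (Multiset G.toUGraph.Path)) :
    Finset (List G.N × Multiset G.toUGraph.Path) :=
  H.biUnion fun M' => M'.toFinset.image fun ρ => (key K ρ, M')

end Grouping

/-- A grouped PMR: a finite set of PMRs that pairwise represent no common path. -/
structure GroupedPMR (G : GraphDB) where
  parts : Finset (PMR G)
  disjoint : ∀ R ∈ parts, ∀ R' ∈ parts, R ≠ R' → ∀ ρ, R.mpaths ρ = 0 ∨ R'.mpaths ρ = 0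

namespace GroupedPMR

variable {G : GraphDB}

def Trim (R : GroupedPMR G) : Prop := ∀ R' ∈ R.parts, R'.Trim

/-- `R` represents `H` if `H = {mpaths(R₁), …, mpaths(Rₖ)}`. -/
def Represents (R : GroupedPMR G) (H : Finset (Multiset G.toUGraph.Path)) : Prop :=
  Multiset.mult '' (H : Set (Multiset G.toUGraph.Path)) = PMR.mpaths '' (R.parts : Set (PMR G))

end GroupedPMR

/-! ## A random access machine with an output tape -/

/-- What the machine prints: a word (an identifier) or a punctuation mark, where
`sep` ends a path inside a group, and `done` ends an element of the enumeration. -/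
inductive Token where
  | word (n : ℕ)
  | sep
  | done

/-- The instructions of the RAM. The machine has a read-only input memory and a work memory;
both have a cell, holding one natural number, at each address. -/
inductive Instr where
  /-- `W[i] := n` -/
  | set (i n : ℕ)
  /-- `W[i] := W[j]` -/
  | move (i j : ℕ)
  /-- `W[i] := W[j] + W[k]` -/
  | add (i j k : ℕ)
  /-- `W[i] := max (W[j] - W[k]) 0` -/
  | sub (i j k : ℕ)
  /-- `W[i] := W[W[j]]` -/
  | load (i j : ℕ)
  /-- `W[W[i]] := W[j]` -/
  | store (i j : ℕ)
  /-- `W[i] := In[W[j]]` -/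
  | read (i j : ℕ)
  /-- go to instruction `l` -/
  | jmp (l : ℕ)
  /-- go to instruction `l` if `W[i] = 0` -/
  | jz (i l : ℕ)
  /-- print `W[i]` -/
  | emit (i : ℕ)
  /-- print `sep` -/
  | emitSep
  /-- print `done` -/
  | emitDone

structure Config where
  /-- the program counter -/
  pc : ℕ
  /-- the work memory -/
  W : ℕ → ℕ
  /-- what has been printed so far -/
  out : List Token

/-- The effect of one instruction, with input memory `inp`. -/
def Instr.exec (inp : ℕ → ℕ) (s : Config) : Instr → Config
  | set i n => ⟨s.pc + 1, Function.update s.W i n, s.out⟩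
  | move i j => ⟨s.pc + 1, Function.update s.W i (s.W j), s.out⟩
  | add i j k => ⟨s.pc + 1, Function.update s.W i (s.W j + s.W k), s.out⟩
  | sub i j k => ⟨s.pc + 1, Function.update s.W i (s.W j - s.W k), s.out⟩
  | load i j => ⟨s.pc + 1, Function.update s.W i (s.W (s.W j)), s.out⟩
  | store i j => ⟨s.pc + 1, Function.update s.W (s.W i) (s.W j), s.out⟩
  | read i j => ⟨s.pc + 1, Function.update s.W i (inp (s.W j)), s.out⟩
  | jmp l => ⟨l, s.W, s.out⟩
  | jz i l => ⟨if s.W i = 0 then l else s.pc + 1, s.W, s.out⟩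
  | emit i => ⟨s.pc + 1, s.W, s.out ++ [Token.word (s.W i)]⟩
  | emitSep => ⟨s.pc + 1, s.W, s.out ++ [Token.sep]⟩
  | emitDone => ⟨s.pc + 1, s.W, s.out ++ [Token.done]⟩

/-- A program of the RAM. The machine halts when the program counter leaves the program. -/
structure Program where
  code : List Instr

namespace Program

def Halted (P : Program) (s : Config) : Prop := P.code.length ≤ s.pc

/-- One step of the machine, taking one unit of time. -/
def step (P : Program) (inp : ℕ → ℕ) (s : Config) : Config :=
  match P.code[s.pc]? with
  | none => s
  | some i => i.exec inp s

/-- The configuration after `n` steps; at the start, the work memory is zero. -/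
def run (P : Program) (inp : ℕ → ℕ) : ℕ → Config
  | 0 => ⟨0, fun _ => 0, []⟩
  | n + 1 => P.step inp (P.run inp n)

/-- With input memory `inp`, the program enumerates the finite multiset `O` with output-linear
delay, with factor `c`: it prints, for some ordering `o₁, …, oₖ` of the elements of `O`
(according to multiplicity), a word `wᵢ` that writes down `oᵢ`, one after the other and nothing
else; if `t i` is the time of finishing `oᵢ`, i.e. the first time at which `w₁ ⋯ wᵢ` has been
printed, and `t 0 = 0`, then `t i - t (i - 1) ≤ c * size oᵢ`; and it halts at most `c` steps after
`t k`. -/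
def EnumeratesWithDelay (P : Program) (inp : ℕ → ℕ) (c : ℕ) {α : Type*}
    (writes : α → List Token → Prop) (size : α → ℕ) (O : Multiset α) : Prop :=
  ∃ (o : List (α × List Token)) (t : ℕ → ℕ),
    ((o.map Prod.fst : List α) : Multiset α) = O ∧
    (∀ x ∈ o, writes x.1 x.2) ∧
    t 0 = 0 ∧
    (∀ (i : ℕ) (hi : i < o.length),
      IsLeast {n | (o.take (i + 1)).flatMap Prod.snd <+: (P.run inp n).out} (t (i + 1)) ∧
      t (i + 1) ≤ t i + c * size o[i].1) ∧
    ∃ n ≤ t o.length + c, P.Halted (P.run inp n) ∧ (P.run inp n).out = o.flatMap Prod.snd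

end Program

/-! ## Writing down the outputs -/

section Output

variable {G : GraphDB}

/-- The sequence `v₀ e₁ v₁ ⋯ eₙ vₙ`. -/
def UGraph.Path.tokens {g : UGraph} (ρ : g.Path) : List Token :=
  Token.word ρ.start.1.code ::
    ρ.steps.flatMap fun x => [Token.word x.1.1.code, Token.word x.2.1.code]

def WritesPath (ρ : G.toUGraph.Path) (w : List Token) : Prop := w = ρ.tokens ++ [Token.done]

def WritesRow (r : G.N × G.N × G.toUGraph.Path) (w : List Token) : Prop :=
  w = Token.word r.1.1.code :: Token.word r.2.1.1.code :: r.2.2.tokens ++ [Token.done]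

def rowSize (r : G.N × G.N × G.toUGraph.Path) : ℕ := r.2.2.size + 2

/-- A group is written down by listing its paths, in any order and according to multiplicity. -/
def WritesGroup (M' : Multiset G.toUGraph.Path) (w : List Token) : Prop :=
  ∃ l : List G.toUGraph.Path, (l : Multiset G.toUGraph.Path) = M' ∧
    w = (l.flatMap fun ρ => ρ.tokens ++ [Token.sep]) ++ [Token.done]

def groupSize (M' : Multiset G.toUGraph.Path) : ℕ := (M'.map UGraph.Path.size).sum

def WritesGroupRow (r : List G.N × Multiset G.toUGraph.Path) (w : List Token) : Prop :=
  ∃ w', WritesGroup r.2 w' ∧ w = (r.1.map fun v => Token.word v.1.code) ++ w'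

def groupRowSize (r : List G.N × Multiset G.toUGraph.Path) : ℕ := groupSize r.2 + r.1.length

end Output

/-! ## Adjacency-list representation of PMRs in the input memory -/

/-- `l` lists each element of `s` exactly once. -/
def IsListing {α : Type*} (l : List α) (s : Set α) : Prop := l.Nodup ∧ ∀ x, x ∈ l ↔ x ∈ s

/-- At address `a` the memory holds the length of `l`, followed by the entries of `l`. -/
def StoresArray (inp : ℕ → ℕ) (a : ℕ) (l : List ℕ) : Prop :=
  inp a = l.length ∧ ∀ (i : ℕ) (hi : i < l.length), inp (a + 1 + i) = l[i]

/-- The memory holds an adjacency-list representation of `R` whose header is at address `a`.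
The header points to an array of all nodes and to an array of the source nodes. Nodes and edges
are given by the addresses of their records. The record of a node `u` holds the identifier
`γ(u)`, a bit that tells whether `u ∈ T`, and a pointer to the array of the outgoing edges of `u`;
the record of an edge `e` holds the identifier `γ(e)` and the two endpoints of `e`.
All arrays are in arbitrary order, and all other cells of the memory are arbitrary. -/
def PMR.StoredAt {G : GraphDB} (R : PMR G) (inp : ℕ → ℕ) (a : ℕ) : Prop :=
  ∃ (nodeAddr : R.N → ℕ) (edgeAddr : R.E → ℕ),
    Function.Injective nodeAddr ∧ Function.Injective edgeAddr ∧
    (∃ l : List R.N, IsListing l Set.univ ∧ StoresArray inp (inp a) (l.map nodeAddr)) ∧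
    (∃ l : List R.N, IsListing l R.S ∧ StoresArray inp (inp (a + 1)) (l.map nodeAddr)) ∧
    (∀ u : R.N,
      inp (nodeAddr u) = (R.γN u).1.code ∧
      inp (nodeAddr u + 1) = flag (u ∈ R.T) ∧
      ∃ l : List R.E, IsListing l {e | (R.η e).1 = u} ∧
        StoresArray inp (inp (nodeAddr u + 2)) (l.map edgeAddr)) ∧
    ∀ e : R.E,
      inp (edgeAddr e) = (R.γE e).1.code ∧
      inp (edgeAddr e + 1) = nodeAddr (R.η e).1 ∧
      inp (edgeAddr e + 2) = nodeAddr (R.η e).2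

/-- A grouped PMR is stored as an array of pointers to the headers of its PMRs. -/
def GroupedPMR.StoredAt {G : GraphDB} (R : GroupedPMR G) (inp : ℕ → ℕ) (a : ℕ) : Prop :=
  ∃ rs : List (PMR G × ℕ), IsListing (rs.map Prod.fst) (R.parts : Set (PMR G)) ∧
    StoresArray inp a (rs.map Prod.snd) ∧ ∀ x ∈ rs, x.1.StoredAt inp x.2

/-! The algorithm is a depth-first search of `R` that prints the current path at every target node.
As `M` is finite, there are finitely many paths from `S` to `T`; by trimness every walk extends to
one of them, so the lengths of walks are bounded (`PMR.exists_bound`). Hence no marking of visited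
nodes is needed: the walks from a source form a finite tree, and each path from `S` to `T` is met
exactly once. Trimness also makes every leaf of this tree a target.

The delay is linear for two reasons. On the way down, each edge costs constant time and every
maximal descent ends in a target, so the waiting time is linear in the path printed next. On the way
up, climbing level by level could cost more than a short next path allows. Therefore a node enters a
linked stack only if untried edges remain when one of its edges is followed, and backtracking jumps
to the top of that stack in constant time.

The verification is symbolic execution in continuation-passing form: `Delivers` carries the time `d`
since the last finished chunk and the chunks still owed, with one rule per instruction. The central
induction is `visitCorrect`: a visit may start with a clock linear in its depth, but always returns
within five steps of a print. `PMR.exists_paths` identifies what is printed with `mpaths`, and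
`Delivers.enumerates` extracts the delays. For grouped input the chunks of one part are merged;
groups are non-empty, so doubling the constant pays for the closing token, and disjointness of the
parts prevents repeated groups. -/

/-! ## Delays of chunks of output -/

namespace Program

variable {P : Program} {inp : ℕ → ℕ} {c d k pc : ℕ} {s s' : Config} {W : ℕ → ℕ}
  {out : List Token} {cs : List (List Token × ℕ)} {w w₁ w₂ : List Token}

/-- Started in `s`, when `d` units of time have passed since the last output, the program prints
the words of the list of pairs `(w, k)`, each with a delay of at most `c * k`, and then halts
within `c` steps. -/
def Delivers (P : Program) (inp : ℕ → ℕ) (c : ℕ) :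
    ℕ → Config → List (List Token × ℕ) → Prop
  | d, s, [] => ∃ n, d + n ≤ c ∧ P.Halted ((P.step inp)^[n] s) ∧
      ((P.step inp)^[n] s).out = s.out
  | d, s, (w, k) :: cs => ∃ m w' x, w = w' ++ [x] ∧ d + (m + 1) ≤ c * k ∧
      ((P.step inp)^[m] s).out = s.out ++ w' ∧ ((P.step inp)^[m + 1] s).out = s.out ++ w ∧
      Delivers P inp c 0 ((P.step inp)^[m + 1] s) cs

namespace Delivers

theorem silent (H : P.Delivers inp c (d + 1) s' cs) (hs : P.step inp s = s')
    (h : s'.out = s.out) : P.Delivers inp c d s cs := by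
  subst hs
  cases cs with
  | nil =>
    obtain ⟨n, h1, h2, h3⟩ := H
    exact ⟨n + 1, by omega, h2, h3.trans h⟩
  | cons x cs =>
    obtain ⟨m, w', y, h1, h2, h3, h4, h5⟩ := H
    exact ⟨m + 1, w', y, h1, by omega, h3.trans (by rw [h]), h4.trans (by rw [h]), h5⟩

theorem print {x : Token} (H : P.Delivers inp c (d + 1) s' ((w, k) :: cs))
    (hs : P.step inp s = s') (h : s'.out = s.out ++ [x]) :
    P.Delivers inp c d s ((x :: w, k) :: cs) := by
  subst hs
  obtain ⟨m, w', y, h1, h2, h3, h4, h5⟩ := H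
  exact ⟨m + 1, x :: w', y, by simp [h1], by omega, h3.trans (by simp [h]),
    h4.trans (by simp [h]), h5⟩

theorem finish {x : Token} (H : P.Delivers inp c 0 s' cs) (hs : P.step inp s = s')
    (h : s'.out = s.out ++ [x]) (hd : d + 1 ≤ c * k) :
    P.Delivers inp c d s (([x], k) :: cs) := by
  subst hs
  exact ⟨0, [], x, rfl, by omega, by simp, h, H⟩

theorem halt (h : P.code.length ≤ pc) (hd : d ≤ c) : P.Delivers inp c d ⟨pc, W, out⟩ [] :=
  ⟨0, hd, h, rfl⟩

/-! ### Symbolic execution: one rule per instruction -/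

theorem step_eq {i : Instr} (h : P.code[s.pc]? = some i) : P.step inp s = i.exec inp s := by
  simp [Program.step, h]

theorem set {i n : ℕ} (h : P.code[pc]? = some (.set i n))
    (H : P.Delivers inp c (d + 1) ⟨pc + 1, Function.update W i n, out⟩ cs) :
    P.Delivers inp c d ⟨pc, W, out⟩ cs := H.silent ((step_eq h).trans rfl) rfl

theorem move {i j : ℕ} (h : P.code[pc]? = some (.move i j))
    (H : P.Delivers inp c (d + 1) ⟨pc + 1, Function.update W i (W j), out⟩ cs) :
    P.Delivers inp c d ⟨pc, W, out⟩ cs := H.silent ((step_eq h).trans rfl) rfl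

theorem add {i j l : ℕ} (h : P.code[pc]? = some (.add i j l))
    (H : P.Delivers inp c (d + 1) ⟨pc + 1, Function.update W i (W j + W l), out⟩ cs) :
    P.Delivers inp c d ⟨pc, W, out⟩ cs := H.silent ((step_eq h).trans rfl) rfl

theorem sub {i j l : ℕ} (h : P.code[pc]? = some (.sub i j l))
    (H : P.Delivers inp c (d + 1) ⟨pc + 1, Function.update W i (W j - W l), out⟩ cs) :
    P.Delivers inp c d ⟨pc, W, out⟩ cs := H.silent ((step_eq h).trans rfl) rfl

theorem load {i j : ℕ} (h : P.code[pc]? = some (.load i j))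
    (H : P.Delivers inp c (d + 1) ⟨pc + 1, Function.update W i (W (W j)), out⟩ cs) :
    P.Delivers inp c d ⟨pc, W, out⟩ cs := H.silent ((step_eq h).trans rfl) rfl

theorem store {i j : ℕ} (h : P.code[pc]? = some (.store i j))
    (H : P.Delivers inp c (d + 1) ⟨pc + 1, Function.update W (W i) (W j), out⟩ cs) :
    P.Delivers inp c d ⟨pc, W, out⟩ cs := H.silent ((step_eq h).trans rfl) rfl

theorem read {i j : ℕ} (h : P.code[pc]? = some (.read i j))
    (H : P.Delivers inp c (d + 1) ⟨pc + 1, Function.update W i (inp (W j)), out⟩ cs) :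
    P.Delivers inp c d ⟨pc, W, out⟩ cs := H.silent ((step_eq h).trans rfl) rfl

theorem jmp {l : ℕ} (h : P.code[pc]? = some (.jmp l))
    (H : P.Delivers inp c (d + 1) ⟨l, W, out⟩ cs) :
    P.Delivers inp c d ⟨pc, W, out⟩ cs := H.silent ((step_eq h).trans rfl) rfl

theorem jz_zero {i l : ℕ} (h : P.code[pc]? = some (.jz i l)) (hi : W i = 0)
    (H : P.Delivers inp c (d + 1) ⟨l, W, out⟩ cs) :
    P.Delivers inp c d ⟨pc, W, out⟩ cs :=
  H.silent ((step_eq h).trans (by simp [Instr.exec, hi])) rfl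

theorem jz_ne {i l : ℕ} (h : P.code[pc]? = some (.jz i l)) (hi : W i ≠ 0)
    (H : P.Delivers inp c (d + 1) ⟨pc + 1, W, out⟩ cs) :
    P.Delivers inp c d ⟨pc, W, out⟩ cs :=
  H.silent ((step_eq h).trans (by simp [Instr.exec, hi])) rfl

theorem emit {i n : ℕ} (h : P.code[pc]? = some (.emit i)) (hn : W i = n)
    (H : P.Delivers inp c (d + 1) ⟨pc + 1, W, out ++ [.word n]⟩ ((w, k) :: cs)) :
    P.Delivers inp c d ⟨pc, W, out⟩ ((.word n :: w, k) :: cs) := by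
  subst hn
  exact H.print ((step_eq h).trans rfl) rfl

theorem emitSep (h : P.code[pc]? = some .emitSep) (hd : d + 1 ≤ c * k)
    (H : P.Delivers inp c 0 ⟨pc + 1, W, out ++ [.sep]⟩ cs) :
    P.Delivers inp c d ⟨pc, W, out⟩ (([.sep], k) :: cs) :=
  H.finish ((step_eq h).trans rfl) rfl hd

theorem emitDone (h : P.code[pc]? = some .emitDone) (hd : d + 1 ≤ c * k)
    (H : P.Delivers inp c 0 ⟨pc + 1, W, out ++ [.done]⟩ cs) :
    P.Delivers inp c d ⟨pc, W, out⟩ (([.done], k) :: cs) :=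
  H.finish ((step_eq h).trans rfl) rfl hd

/-- Consecutive chunks can be regarded as one. -/
theorem merge₂ {k₁ k₂ : ℕ} (H : P.Delivers inp c d s ((w₁, k₁) :: (w₂, k₂) :: cs)) :
    P.Delivers inp c d s ((w₁ ++ w₂, k₁ + k₂) :: cs) := by
  obtain ⟨m, w', x, h1, h2, h3, h4, m', w'', x', g1, g2, g3, g4, g5⟩ := H
  have e (n : ℕ) : (P.step inp)^[n] ((P.step inp)^[m + 1] s) = (P.step inp)^[m + 1 + n] s := by
    rw [← Function.iterate_add_apply, Nat.add_comm]
  rw [e] at g3 g4 g5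
  -- The clock of the second chunk starts at `0`, so the two waiting times add up to at most `c * k₁
  -- + c * k₂`.
  refine ⟨m + 1 + m', w₁ ++ w'', x', by simp [g1], by rw [mul_add]; omega, ?_, ?_, g5⟩
  · rw [g3, h4, List.append_assoc]
  · exact g4.trans (by rw [h4, List.append_assoc])

theorem merge {l : List (List Token × ℕ)} (hl : l ≠ []) (H : P.Delivers inp c d s (l ++ cs)) :
    P.Delivers inp c d s ((l.flatMap Prod.fst, (l.map Prod.snd).sum) :: cs) := by
  induction l generalizing d s with
  | nil => exact absurd rfl hl
  | cons a l ih =>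
    by_cases h : l = []
    · subst h
      simpa using H
    · have : P.Delivers inp c d s (a :: (l.flatMap Prod.fst, (l.map Prod.snd).sum) :: cs) := by
        obtain ⟨m, w', x, h1, h2, h3, h4, h5⟩ := H
        exact ⟨m, w', x, h1, h2, h3, h4, ih h h5⟩
      simpa using this.merge₂

/-- Turns delays per path into delays per group. Empty blocks are excluded because a chunk must have
a last token, whose printing stops the clock. -/
theorem merge_flatMap {α : Type*} {f : α → List (List Token × ℕ)} {l : List α}
    (hl : ∀ a ∈ l, f a ≠ []) (H : P.Delivers inp c d s (l.flatMap f)) :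
    P.Delivers inp c d s (l.map fun a => ((f a).flatMap Prod.fst, ((f a).map Prod.snd).sum)) := by
  induction l generalizing d s with
  | nil => exact H
  | cons a l ih =>
    have := merge (hl a (by simp)) (by simpa using H)
    obtain ⟨m, w', x, h1, h2, h3, h4, h5⟩ := this
    exact ⟨m, w', x, h1, h2, h3, h4, ih (fun b hb => hl b (by simp [hb])) h5⟩

end Delivers

/-! ### From deliveries to absolute times -/

theorem out_prefix_step (P : Program) (inp : ℕ → ℕ) (s : Config) :
    s.out <+: (P.step inp s).out := by
  unfold Program.step
  split
  · exact List.prefix_rfl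
  · rename_i i _
    cases i <;> simp [Instr.exec]

theorem run_eq_iterate (P : Program) (inp : ℕ → ℕ) (n m : ℕ) :
    P.run inp (n + m) = (P.step inp)^[m] (P.run inp n) := by
  induction m with
  | zero => rfl
  | succ m ih => rw [Function.iterate_succ_apply', ← ih]; rfl

theorem out_prefix_run (P : Program) (inp : ℕ → ℕ) {n m : ℕ} (h : n ≤ m) :
    (P.run inp n).out <+: (P.run inp m).out := by
  induction h with
  | refl => exact List.prefix_rfl
  | step _ ih => exact ih.trans (out_prefix_step P inp _)

theorem Delivers.exists_times {N : ℕ} (H : P.Delivers inp c 0 (P.run inp N) cs) :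
    ∃ t : ℕ → ℕ, t 0 = N ∧
      (∀ (i : ℕ) (hi : i < cs.length),
        IsLeast {n | (P.run inp N).out ++ (cs.take (i + 1)).flatMap Prod.fst <+:
          (P.run inp n).out} (t (i + 1)) ∧ t (i + 1) ≤ t i + c * cs[i].2) ∧
      ∃ n ≤ t cs.length + c, P.Halted (P.run inp n) ∧
        (P.run inp n).out = (P.run inp N).out ++ cs.flatMap Prod.fst := by
  induction cs generalizing N with
  | nil =>
    obtain ⟨n, h1, h2, h3⟩ := H
    rw [← run_eq_iterate] at h2 h3
    exact ⟨fun _ => N, rfl, by simp, N + n, by simpa using h1, h2, by simp [h3]⟩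
  | cons a cs ih =>
    obtain ⟨w, k⟩ := a
    obtain ⟨m, w', x, h1, h2, h3, h4, h5⟩ := H
    rw [← run_eq_iterate] at h3 h4 h5
    obtain ⟨t, t0, ht, n, hn, g1, g2⟩ := ih h5
    refine ⟨fun i => Nat.casesOn i N t, rfl, ?_, n, hn, g1, by simp [g2, h4]⟩
    rintro (_ | i) hi
    · constructor
      · simp only [t0]
        constructor
        · simp [h4]
        -- Minimality: after `m` steps only `w'` has been printed, one token short of `w`, and the
        -- output never shrinks.
        · intro n hn
          by_contra! hlt
          have := hn.length_le.trans (out_prefix_run P inp (show n ≤ N + m by omega)).length_le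
          rw [h3] at this
          simp [h1] at this
      · simpa [t0, Nat.add_assoc] using h2
    · have := ht i (by simpa using hi)
      rw [h4] at this
      simpa using this

/-- Two constants occur because the total weight of the chunks of an element may exceed its size, as
happens with the closing token of a group. -/
theorem Delivers.enumerates {α β : Type*} {writes : α → List Token → Prop} {size : α → ℕ}
    {C : ℕ} {o : List β} {g : β → α} {f : β → List (List Token × ℕ)}
    (H : P.Delivers inp c 0 (P.run inp 0) (o.flatMap f)) (hne : ∀ b ∈ o, f b ≠ [])
    (hw : ∀ b ∈ o, writes (g b) ((f b).flatMap Prod.fst))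
    (hsize : ∀ b ∈ o, c * ((f b).map Prod.snd).sum ≤ C * size (g b)) (hC : c ≤ C) :
    P.EnumeratesWithDelay inp C writes size (o.map g : List α) := by
  obtain ⟨t, t0, ht, n, hn, h1, h2⟩ := (H.merge_flatMap hne).exists_times
  have hout : (P.run inp 0).out = [] := rfl
  refine ⟨o.map fun b => (g b, (f b).flatMap Prod.fst), t, by simp [Function.comp_def],
    by simpa using hw, t0, ?_, n, ?_, h1, ?_⟩
  · intro i hi
    have hi' : i < o.length := by simpa using hi
    have := ht i (by simpa using hi)
    have e := hsize o[i] (by simp)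
    simp only [hout, List.nil_append, ← List.map_take, List.flatMap_map, List.getElem_map]
      at this ⊢
    exact ⟨this.1, this.2.trans (by omega)⟩
  · simp only [List.length_map] at hn ⊢
    omega
  · rw [h2, hout]
    simp [List.flatMap_map]

end Program

/-! ## The program -/

/-- The variants of the enumeration: whether the input is a grouped PMR, which endpoints are
printed before a path, and whether they are printed only before the first path of a PMR. -/
structure Mode where
  grouped : Bool
  src : Bool
  tgt : Bool
  once : Bool

/-- The current path is kept in records of five cells, the first one at address `20`: edge, node,
and, for a node with untried outgoing edges, the position in the list of outgoing edges, the number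
of untried edges, and the closest ancestor with untried edges. Register `10` points to the last
record, and register `14` to the last record with untried edges. -/
def enumProgram (m : Mode) : Program where
  code := [
    .set 1 1,
    .set 2 2,
    .set 5 5,
    if m.grouped then .read 4 0 else .set 4 1,
    .jz 4 71, -- 4: next PMR
    .sub 4 4 1,
    .add 3 3 1,
    if m.grouped then .read 15 3 else .set 15 0,
    .add 15 15 1,
    .read 6 15,
    .read 7 6,
    .set 9 1,
    .jz 7 69, -- 12: next source
    .sub 7 7 1,
    .add 6 6 1,
    .read 11 6,
    .read 8 11,
    .set 10 20,
    .read 16 11, -- 18: visit a node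
    .add 15 10 1,
    .store 15 16,
    .add 15 11 1,
    .read 15 15,
    .jz 15 39,
    .jz 9 28,
    -- Here `.set 15 0` only fills the place, so that jump targets do not depend on the mode;
    -- register `15` is scratch.
    if m.src then .emit 8 else .set 15 0,
    if m.tgt then .emit 16 else .set 15 0,
    if m.once then .set 9 0 else .set 15 0,
    .set 17 20, -- 28: print the path
    .add 15 17 1,
    .load 16 15,
    .emit 16,
    .sub 15 10 17,
    .jz 15 38,
    .add 17 17 5,
    .load 16 17,
    .emit 16,
    .jmp 29,
    if m.grouped then .emitSep else .emitDone,
    .add 15 11 2, -- 39: expand a node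
    .read 12 15,
    .read 13 12,
    .jz 13 60,
    .sub 13 13 1, -- 43: next edge
    .add 12 12 1,
    .jz 13 53,
    .add 15 10 2,
    .store 15 12,
    .add 15 15 1,
    .store 15 13,
    .add 15 15 1,
    .store 15 14,
    .move 14 10,
    .read 15 12, -- 53: follow an edge
    .add 10 10 5,
    .read 16 15,
    .store 10 16,
    .add 15 15 2,
    .read 11 15,
    .jmp 18,
    .jz 14 12, -- 60: backtrack
    .move 10 14,
    .add 15 10 2,
    .load 12 15,
    .add 15 15 1,
    .load 13 15,
    .add 15 15 1,
    .load 14 15,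
    .jmp 43,
    if m.grouped then .emitDone else .set 15 0, -- 69: end of a PMR
    .jmp 4]

/-! ## The output of the program -/

/-- The tokens of a path, given by identifiers. -/
def codeTokens (x : ℕ) (s : List (ℕ × ℕ)) : List Token :=
  .word x :: s.flatMap fun y => [.word y.1, .word y.2]

/-- The last node of a path with first node `x`. -/
def lastNode {α β : Type*} : β → List (α × β) → β
  | x, [] => x
  | _, y :: s => lastNode y.2 s

theorem lastNode_append {α β : Type*} (x : β) (s s' : List (α × β)) :
    lastNode x (s ++ s') = lastNode (lastNode x s) s' := by
  induction s generalizing x with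
  | nil => rfl
  | cons y s ih => exact ih y.2

/-- The endpoints that are printed before a path. -/
def headTokens (m : Mode) (x : ℕ) (s : List (ℕ × ℕ)) : List Token :=
  (if m.src then [.word x] else []) ++ if m.tgt then [.word (lastNode x s)] else []

def endToken (m : Mode) : Token := if m.grouped then .sep else .done

/-- The weight counts the path alone; endpoints printed before it are paid for by the path. -/
def chunk (m : Mode) (f : Bool) (x : ℕ) (s : List (ℕ × ℕ)) : List Token × ℕ :=
  ((if f then headTokens m x s else []) ++ (codeTokens x s ++ [endToken m]), 2 * s.length + 1)

/-- The chunks printed for a list of paths; `f` tells whether the endpoints are to be printed. -/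
def chunks (m : Mode) : Bool → List (ℕ × List (ℕ × ℕ)) → List (List Token × ℕ)
  | _, [] => []
  | f, y :: l => chunk m f y.1 y.2 :: chunks m (f && !m.once) l

/-- Mirrors register `9`: whether endpoints are still to be printed once the paths of the list have
been. -/
def flagAfter (m : Mode) : Bool → List (ℕ × List (ℕ × ℕ)) → Bool
  | f, [] => f
  | f, _ :: l => flagAfter m (f && !m.once) l

theorem chunks_append (m : Mode) (f : Bool) (l l' : List (ℕ × List (ℕ × ℕ))) :
    chunks m f (l ++ l') = chunks m f l ++ chunks m (flagAfter m f l) l' := by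
  induction l generalizing f with
  | nil => rfl
  | cons y l ih => simp [chunks, flagAfter, ih]

theorem flagAfter_append (m : Mode) (f : Bool) (l l' : List (ℕ × List (ℕ × ℕ))) :
    flagAfter m f (l ++ l') = flagAfter m (flagAfter m f l) l' := by
  induction l generalizing f with
  | nil => rfl
  | cons y l ih => simp [flagAfter, ih]

/-- The array that is stored at address `a`. -/
def arrayAt (inp : ℕ → ℕ) (a : ℕ) : List ℕ := (List.range (inp a)).map fun i => inp (a + 1 + i)

/-- The addresses of the outgoing edges of the node at address `u`. -/
def outEdges (inp : ℕ → ℕ) (u : ℕ) : List ℕ := arrayAt inp (inp (u + 2))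

/-- The paths with fewer than `n` edges from the node at address `u` to a target node. -/
def pathsFrom (inp : ℕ → ℕ) : ℕ → ℕ → List (List (ℕ × ℕ))
  | 0, _ => []
  | n + 1, u => (if inp (u + 1) = 0 then [] else [[]]) ++
      (outEdges inp u).flatMap fun e =>
        (pathsFrom inp n (inp (e + 2))).map ((inp e, inp (inp (e + 2))) :: ·)

/-- The paths of the PMR whose header is at address `a`, provided that they have fewer than `n`
edges: their first node and the remaining edges and nodes. -/
def pathsOfPMR (inp : ℕ → ℕ) (n a : ℕ) : List (ℕ × List (ℕ × ℕ)) :=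
  (arrayAt inp (inp (a + 1))).flatMap fun u => (pathsFrom inp n u).map fun s => (inp u, s)

/-- All paths from the node at address `u` have fewer than `n` edges, and maximal ones end in a
target node. -/
def Productive (inp : ℕ → ℕ) : ℕ → ℕ → Prop
  | 0, _ => False
  | n + 1, u => (outEdges inp u = [] → inp (u + 1) ≠ 0) ∧
      ∀ e ∈ outEdges inp u, Productive inp n (inp (e + 2))

/-! ## Memory contents -/

/-- The path `x :: s` is stored at address `q`. -/
def StoresPath (W : ℕ → ℕ) : ℕ → ℕ → List (ℕ × ℕ) → Prop
  | q, x, [] => W (q + 1) = x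
  | q, x, y :: s => W (q + 1) = x ∧ W (q + 5) = y.1 ∧ StoresPath W (q + 5) y.2 s

/-- The range ends after the node cell of the last record, so the three bookkeeping cells of that
record may be overwritten freely. -/
theorem StoresPath.congr {W W' : ℕ → ℕ} {q x : ℕ} {s : List (ℕ × ℕ)} (h : StoresPath W q x s)
    (hW : ∀ a, q ≤ a → a < q + 5 * s.length + 2 → W' a = W a) : StoresPath W' q x s := by
  induction s generalizing q x with
  | nil => exact (hW _ (by omega) (by simp)).trans h
  | cons y s ih =>
    simp only [List.length_cons] at hW
    exact ⟨(hW _ (by omega) (by omega)).trans h.1, (hW _ (by omega) (by omega)).trans h.2.1,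
      ih h.2.2 fun a h1 h2 => hW a (by omega) (by omega)⟩

theorem StoresPath.concat {W : ℕ → ℕ} {q x e v : ℕ} {s : List (ℕ × ℕ)} (h : StoresPath W q x s)
    (he : W (q + 5 * s.length + 5) = e) (hv : W (q + 5 * s.length + 6) = v) :
    StoresPath W q x (s ++ [(e, v)]) := by
  induction s generalizing q x with
  | nil => exact ⟨h, he, hv⟩
  | cons y s ih =>
    simp only [List.length_cons] at he hv
    exact ⟨h.1, h.2.1, ih h.2.2 (by rw [← he]; congr 1; ring) (by rw [← hv]; congr 1; ring)⟩

/-- The constant registers. -/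
structure ConstRegs (W : ℕ → ℕ) : Prop where
  one : W 1 = 1
  two : W 2 = 2
  five : W 5 = 5

/-- The cells that are not changed by the visit of a node whose record is at address `p`. -/
structure SameBelow (p : ℕ) (W W' : ℕ → ℕ) : Prop where
  regs : ∀ a ≤ 8, W' a = W a
  mem : ∀ a, 20 ≤ a → a < p → W' a = W a
  top : W' 14 = W 14

theorem SameBelow.trans {p p' : ℕ} {W W' W'' : ℕ → ℕ} (h : SameBelow p W W')
    (h' : SameBelow p' W' W'') (hp : p ≤ p') : SameBelow p W W'' where
  regs a ha := (h'.regs a ha).trans (h.regs a ha)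
  mem a ha hap := (h'.mem a ha (by omega)).trans (h.mem a ha hap)
  top := h'.top.trans h.top

theorem SameBelow.constRegs {p : ℕ} {W W' : ℕ → ℕ} (h : SameBelow p W W') (hW : ConstRegs W) :
    ConstRegs W' :=
  ⟨(h.regs 1 (by simp)).trans hW.one, (h.regs 2 (by simp)).trans hW.two,
    (h.regs 5 (by simp)).trans hW.five⟩

/-! ### Correctness and running time of the program -/

section Verification

open Program

variable {m : Mode} {inp : ℕ → ℕ} {d k n x u : ℕ} {W : ℕ → ℕ} {out : List Token}
  {cs : List (List Token × ℕ)} {f : Bool} {pre s : List (ℕ × ℕ)}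

/-- A full round of the loop takes 9 steps, the last partial one 5. The form `q + 20` makes it
evident that records do not overlap the scratch registers. -/
theorem delivers_printLoop {q : ℕ} (hW : ConstRegs W) (h17 : W 17 = q + 20)
    (h10 : W 10 = q + 20 + 5 * s.length) (hs : StoresPath W (q + 20) x s)
    (H : ∀ W' out' d', (∀ a, a < 15 ∨ 17 < a → W' a = W a) → d' ≤ d + 9 * s.length + 5 →
      (enumProgram m).Delivers inp 100 d' ⟨38, W', out'⟩ (([endToken m], k) :: cs)) :
    (enumProgram m).Delivers inp 100 d ⟨29, W, out⟩
      ((codeTokens x s ++ [endToken m], k) :: cs) := by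
  have h1 := hW.one
  have h5 := hW.five
  induction s generalizing q x d W out with
  | nil =>
    refine .add rfl (.load rfl (.emit (n := x) rfl ?_ (.sub rfl (.jz_zero rfl ?_ (H _ _ _ ?_ ?_)))))
    · have : W (q + 20 + 1) = x := hs
      simpa [h17, h1] using this
    · simp [h17, h10]
    · intro a ha
      have : a ≠ 15 ∧ a ≠ 16 := by omega
      simp [this]
    · simp
  | cons y s ih =>
    obtain ⟨hs1, hs2, hs3⟩ := hs
    simp only [List.length_cons] at h10 H
    refine .add rfl (.load rfl (.emit (n := x) rfl ?_ (.sub rfl (.jz_ne rfl ?_ (.add rfl (.load rfl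
      (.emit (n := y.1) (w := codeTokens y.2 s ++ [endToken m]) rfl ?_
        (.jmp rfl (ih (q := q + 5) ?_ ?_ ?_ ?_ ?_ ?_ ?_)))))))))
    · simpa [h17, h1] using hs1
    · simp [h17, h10]
    · simpa [h17, h5] using hs2
    · exact ⟨by simp [h1], by simp [Function.update_apply, hW.two],
        by simp [h5]⟩
    · simp [h17, h5]
    · simp [h10]; omega
    · refine (show q + 20 + 5 = q + 5 + 20 by omega) ▸ hs3.congr fun a h _ => ?_
      have : a ≠ 15 ∧ a ≠ 16 ∧ a ≠ 17 := by omega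
      simp [this]
    · intro W' out' d' hW' hd'
      refine H _ _ _ (fun a ha => ?_) (by omega)
      have : a ≠ 15 ∧ a ≠ 16 ∧ a ≠ 17 := by omega
      simp [hW' a ha, this]
    · simp [h1]
    · simp [h5]

theorem delivers_printPath (hW : ConstRegs W) (h10 : W 10 = 20 + 5 * s.length)
    (hs : StoresPath W 20 x s) (hd : d + 9 * s.length + 7 ≤ 100 * (2 * s.length + 1))
    (H : ∀ W' out', (∀ a, a < 15 ∨ 17 < a → W' a = W a) →
      (enumProgram m).Delivers inp 100 0 ⟨39, W', out'⟩ cs) :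
    (enumProgram m).Delivers inp 100 d ⟨28, W, out⟩ ((codeTokens x s ++ [endToken m],
      2 * s.length + 1) :: cs) := by
  refine .set rfl (delivers_printLoop (q := 0) ⟨?_, ?_, ?_⟩ ?_ ?_ ?_ ?_)
  · simp [hW.one]
  · simp [hW.two]
  · simp [hW.five]
  · simp
  · simp [h10]
  · exact hs.congr fun a h _ => by
      have : a ≠ 17 := by omega
      simp [this]
  · intro W' out' d' hW' hd'
    have hW'' : ∀ a, a < 15 ∨ 17 < a → W' a = W a := fun a ha => by
      have : a ≠ 17 := by omega
      simp [hW' a ha, this]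
    obtain ⟨g, b, c, e⟩ := m
    cases g
    · exact .emitDone rfl (by omega) (H _ _ hW'')
    · exact .emitSep rfl (by omega) (H _ _ hW'')

theorem delivers_print (hW : ConstRegs W) (h8 : W 8 = x) (h9 : W 9 = f.toNat)
    (h16 : W 16 = lastNode x s) (h10 : W 10 = 20 + 5 * s.length)
    (hs : StoresPath W 20 x s) (hd : d + 9 * s.length + 11 ≤ 100 * (2 * s.length + 1))
    (H : ∀ W' out', (∀ a, a ≠ 9 → a < 15 ∨ 17 < a → W' a = W a) →
      W' 9 = (f && !m.once).toNat → (enumProgram m).Delivers inp 100 0 ⟨39, W', out'⟩ cs) :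
    (enumProgram m).Delivers inp 100 d ⟨24, W, out⟩ (chunk m f x s :: cs) := by
  cases f with
  | false =>
    refine .jz_zero rfl h9 (delivers_printPath hW h10 hs (by omega) fun W' out' hW' => ?_)
    exact H _ _ (fun a _ ha => hW' a ha) ((hW' 9 (by simp)).trans (by simpa using h9))
  | true =>
    -- Everything from instruction 28 on is common to all modes; the eight cases below differ only
    -- in the three instructions before it.
    have key : ∀ W₁ d₁ out₁, (∀ a, a ≠ 9 → a < 15 ∨ 17 < a → W₁ a = W a) →
        W₁ 9 = (!m.once).toNat → d₁ ≤ d + 4 → (enumProgram m).Delivers inp 100 d₁ ⟨28, W₁, out₁⟩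
          ((codeTokens x s ++ [endToken m], 2 * s.length + 1) :: cs) := by
      intro W₁ d₁ out₁ hW₁ h9' hd₁
      refine delivers_printPath ⟨?_, ?_, ?_⟩ ?_ ?_ (by omega) ?_
      · rw [hW₁ _ (by simp) (by simp), hW.one]
      · rw [hW₁ _ (by simp) (by simp), hW.two]
      · rw [hW₁ _ (by simp) (by simp), hW.five]
      · rw [hW₁ _ (by simp) (by simp), h10]
      · exact hs.congr fun a h _ => hW₁ a (by omega) (by omega)
      · intro W' out' hW'
        refine H _ _ (fun a h9 ha => (hW' a ha).trans (hW₁ a h9 ha)) ?_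
        rw [hW' 9 (by simp), h9']
        simp
    have h9' : W 9 = 1 := h9
    obtain ⟨g, b, c, e⟩ := m
    refine .jz_ne rfl (by simp [h9]) ?_
    simp only [chunk, headTokens, if_true]
    cases b <;> cases c <;> cases e <;>
      simp only [if_true, Bool.false_eq_true, if_false, List.nil_append, List.cons_append]
    · exact .set rfl (.set rfl (.set rfl (key _ _ _ (fun a h h' => by
        have : a ≠ 15 := by omega
        simp [this]) (by simp [h9']) (by omega))))
    · exact .set rfl (.set rfl (.set rfl (key _ _ _ (fun a h h' => by
        have : a ≠ 15 := by omega
        simp [this, h]) (by simp) (by omega))))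
    · exact .set rfl (.emit rfl (by simp [h16]) (.set rfl (key _ _ _ (fun a h h' => by
        have : a ≠ 15 := by omega
        simp [this]) (by simp [h9']) (by omega))))
    · exact .set rfl (.emit rfl (by simp [h16]) (.set rfl (key _ _ _ (fun a h h' => by
        have : a ≠ 15 := by omega
        simp [this, h]) (by simp) (by omega))))
    · exact .emit rfl h8 (.set rfl (.set rfl (key _ _ _ (fun a h h' => by
        have : a ≠ 15 := by omega
        simp [this]) (by simp [h9']) (by omega))))
    · exact .emit rfl h8 (.set rfl (.set rfl (key _ _ _ (fun a h h' => by
        have : a ≠ 15 := by omega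
        simp [this, h]) (by simp) (by omega))))
    · exact .emit rfl h8 (.emit rfl (by simp [h16]) (.set rfl (key _ _ _ (fun a h h' => by
        have : a ≠ 15 := by omega
        simp [this]) (by simp [h9']) (by omega))))
    · exact .emit rfl h8 (.emit rfl (by simp [h16]) (.set rfl (key _ _ _ (fun a h h' => by
        simp [h]) (by simp) (by omega))))

/-- The paths of `chunks` that extend `pre` by an element of `l`. -/
def extend (x : ℕ) (pre : List (ℕ × ℕ)) (l : List (List (ℕ × ℕ))) : List (ℕ × List (ℕ × ℕ)) :=
  l.map fun s => (x, pre ++ s)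

/-- The continuation `cs` is correctly delivered after backtracking from a record at `p`. -/
def Resumes (m : Mode) (inp : ℕ → ℕ) (p : ℕ) (W : ℕ → ℕ) (f : Bool)
    (cs : List (List Token × ℕ)) : Prop :=
  -- The bound 5 does not depend on the clock at the start of the visit: a visit never ends without
  -- having just printed.
  ∀ W' out d, SameBelow p W W' → W' 9 = f.toNat → d ≤ 5 →
    (enumProgram m).Delivers inp 100 d ⟨60, W', out⟩ cs

/-- The visit of the node at address `u` prints all paths through it. -/
def VisitCorrect (m : Mode) (inp : ℕ → ℕ) (n u : ℕ) : Prop :=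
  ∀ W out d x pre f cs, ConstRegs W → W 8 = x → W 9 = Bool.toNat f →
    W 10 = 20 + 5 * pre.length → W 11 = u → lastNode x pre = inp u →
    -- The update anticipates the first action of a visit, which writes the identifier of the node
    -- into its record.
    StoresPath (Function.update W (21 + 5 * pre.length) (inp u)) 20 x pre →
    -- At most 27 steps lead from the visit of a node to that of its first child if nothing is
    -- printed, so 30 per level suffice.
    d ≤ 30 * pre.length + 30 →
    Resumes m inp (20 + 5 * pre.length) W
      (flagAfter m f (extend x pre (pathsFrom inp n u))) cs →
    (enumProgram m).Delivers inp 100 d ⟨18, W, out⟩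
      (chunks m f (extend x pre (pathsFrom inp n u)) ++ cs)

/-- The child's record starts at `p`, so the frame condition protects the whole current record,
including its bookkeeping cells. -/
theorem delivers_followEdge {e p : ℕ} (hv : VisitCorrect m inp n (inp (e + 2))) (hW : ConstRegs W)
    (h8 : W 8 = x) (h9 : W 9 = f.toNat) (h10 : W 10 = 20 + 5 * pre.length) (h12 : inp (W 12) = e)
    (hpre : StoresPath W 20 x pre) (hd : d ≤ 30 * pre.length + 53) (hp : p = 25 + 5 * pre.length)
    (H : Resumes m inp p W
      (flagAfter m f (extend x (pre ++ [(inp e, inp (inp (e + 2)))])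
        (pathsFrom inp n (inp (e + 2))))) cs) :
    (enumProgram m).Delivers inp 100 d ⟨53, W, out⟩
      (chunks m f (extend x (pre ++ [(inp e, inp (inp (e + 2)))])
        (pathsFrom inp n (inp (e + 2)))) ++ cs) := by
  have h2 := hW.two
  have h5 := hW.five
  -- With the depth abstracted, record addresses take the form `l` plus a numeral at least 20, which
  -- `simp` can tell apart from registers.
  obtain ⟨l, hl⟩ : ∃ l, l = 5 * pre.length := ⟨_, rfl⟩
  have h10' : W 10 = l + 20 := by omega
  refine .read rfl (.add rfl (.read rfl (.store rfl (.add rfl (.read rfl (.jmp rfl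
    (hv _ _ _ _ _ _ _ ⟨?_, ?_, ?_⟩ ?_ ?_ ?_ ?_ ?_ ?_ ?_ ?_)))))))
  · simp [h10', h5, hW.one]
  · simp [h10', h5, h2]
  · simp [h10', h5]
  · simp [h10', h5, h8]
  · simp [h10', h5, h9]
  · simp [h10', h5]; omega
  · simp [h10', h5, h12, h2]
  · simp [lastNode_append, lastNode]
  · refine StoresPath.concat ?_ ?_ ?_
    · refine hpre.congr fun a h h' => ?_
      have : a ≠ 10 ∧ a ≠ 11 ∧ a ≠ 15 ∧ a ≠ 16 ∧ a ≠ l + 25 ∧ a ≠ l + 26 := by omega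
      simp [Function.update_apply, h10', h5, this, mul_add, ← hl]
      omega
    · simp [h10', h5, h12, mul_add, ← hl, Nat.add_comm _ l,
        ← Nat.add_assoc]
    · simp [mul_add, ← hl, Nat.add_comm _ l, ← Nat.add_assoc]
  · simp; omega
  · intro W' out' d' hs h9' hd'
    refine H _ _ _ ⟨fun a ha => ?_, fun a h h' => ?_, ?_⟩ h9' hd'
    · have : a ≠ 10 ∧ a ≠ 11 ∧ a ≠ 15 ∧ a ≠ 16 ∧ a ≠ l + 25 ∧ a ≠ l + 26 := by omega
      simp [hs.regs a ha, h10', h5, this]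
    · have : a ≠ 10 ∧ a ≠ 11 ∧ a ≠ 15 ∧ a ≠ 16 ∧ a ≠ l + 25 ∧ a ≠ l + 26 := by omega
      rw [hs.mem a h (by simp; omega)]
      simp [h10', h5, this]
    · simp [hs.top, h10', h5]

/-- The paths that start with an edge in `l` and have at most `n` edges. -/
def pathsAlong (inp : ℕ → ℕ) (n : ℕ) (l : List ℕ) : List (List (ℕ × ℕ)) :=
  l.flatMap fun e => (pathsFrom inp n (inp (e + 2))).map ((inp e, inp (inp (e + 2))) :: ·)

theorem extend_pathsAlong_cons (x : ℕ) (pre : List (ℕ × ℕ)) (e : ℕ) (l : List ℕ) :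
    extend x pre (pathsAlong inp n (e :: l)) =
      extend x (pre ++ [(inp e, inp (inp (e + 2)))]) (pathsFrom inp n (inp (e + 2))) ++
        extend x pre (pathsAlong inp n l) := by
  simp [extend, pathsAlong]

/-- Induction on the untried edges. For the last one nothing is pushed, so the child returns
directly to the ancestor on top of the stack and the continuation passes through unchanged.
Otherwise position, count and old top are saved in the record, and the child returns here. -/
theorem delivers_nextEdge {a : ℕ} {l : List ℕ} (hl : l ≠ [])
    (hv : ∀ e ∈ l, VisitCorrect m inp n (inp (e + 2))) (hW : ConstRegs W)
    (h8 : W 8 = x) (h9 : W 9 = f.toNat) (h10 : W 10 = 20 + 5 * pre.length) (h12 : W 12 = a)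
    (h13 : W 13 = l.length) (ha : ∀ i (hi : i < l.length), inp (a + 1 + i) = l[i])
    (hpre : StoresPath W 20 x pre) (hd : d ≤ 30 * pre.length + 43)
    (H : Resumes m inp (20 + 5 * pre.length) W
      (flagAfter m f (extend x pre (pathsAlong inp n l))) cs) :
    (enumProgram m).Delivers inp 100 d ⟨43, W, out⟩
      (chunks m f (extend x pre (pathsAlong inp n l)) ++ cs) := by
  induction l generalizing W d f a out with
  | nil => exact absurd rfl hl
  | cons e l ih =>
    have h1 := hW.one
    have h2 := hW.two
    have h5 := hW.five
    have he : inp (a + 1) = e := ha 0 (by simp)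
    obtain ⟨r, hr⟩ : ∃ r, r = 5 * pre.length := ⟨_, rfl⟩
    have h10' : W 10 = r + 20 := by omega
    simp only [List.length_cons] at h13
    rw [extend_pathsAlong_cons, flagAfter_append] at H
    rw [extend_pathsAlong_cons, chunks_append, List.append_assoc]
    refine .sub rfl (.add rfl ?_)
    rcases eq_or_ne l [] with rfl | hl'
    · refine .jz_zero rfl ?_ (delivers_followEdge (hv e (by simp)) ⟨?_, ?_, ?_⟩ ?_ ?_ ?_ ?_ ?_
        ?_ rfl ?_)
      · simp [h13, h1]
      · simp [h1]
      · simp [h2]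
      · simp [h5]
      · simp [h8]
      · simp [h9]
      · simp [h10]
      · simp [h12, h1, he]
      · refine hpre.congr fun b h h' => ?_
        have : b ≠ 12 ∧ b ≠ 13 := by omega
        simp [this]
      · omega
      · intro W' out' d' hs h9' hd'
        refine H _ _ _ ⟨fun b hb => ?_, fun b h h' => ?_, ?_⟩ h9' hd'
        · have : b ≠ 12 ∧ b ≠ 13 := by omega
          simp [hs.regs b hb, this]
        · have : b ≠ 12 ∧ b ≠ 13 := by omega
          simp [hs.mem b h (by omega), this]
        · simp [hs.top]
    · have hlen : l.length ≠ 0 := by simpa using hl'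
      refine .jz_ne rfl ?_ (.add rfl (.store rfl (.add rfl (.store rfl (.add rfl (.store rfl
        (.move rfl (delivers_followEdge (hv e (by simp)) ⟨?_, ?_, ?_⟩ ?_ ?_ ?_ ?_ ?_
        ?_ rfl ?_))))))))
      · simpa [h13, h1] using hlen
      · simp [h1, h2, h10']
      · simp [h1, h2, h10']
      · simp [h1, h2, h5, h10']
      · simp [h1, h2, h8, h10']
      · simp [h1, h2, h9, h10']
      · simp [h1, h2, h10']; omega
      · simp [h1, h2, h10', h12, he]
      · refine hpre.congr fun b h h' => ?_
        have : b ≠ 12 ∧ b ≠ 13 ∧ b ≠ 14 ∧ b ≠ 15 ∧ b ≠ r + 22 ∧ b ≠ r + 23 ∧ b ≠ r + 24 := by omega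
        simp [h1, h2, h10', this]
      · omega
      · intro W' out' d' hs h9' hd'
        have hp : W' 14 = r + 20 := by
          rw [hs.top]
          simp [h1, h2, h10']
        have hregs : ∀ b ≤ 8, W' b = W b := fun b hb => by
          have : b ≠ 12 ∧ b ≠ 13 ∧ b ≠ 14 ∧ b ≠ 15 ∧ b ≠ r + 22 ∧ b ≠ r + 23 ∧ b ≠ r + 24 := by
            omega
          simp [hs.regs b hb, h1, h2, h10', this]
        have hmem : ∀ b, 20 ≤ b → b < r + 22 → W' b = W b := fun b h h' => by
          have : b ≠ 12 ∧ b ≠ 13 ∧ b ≠ 14 ∧ b ≠ 15 ∧ b ≠ r + 22 ∧ b ≠ r + 23 ∧ b ≠ r + 24 := by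
            omega
          rw [hs.mem b h (by omega)]
          simp [h1, h2, h10', this]
        have hptr : W' (r + 22) = a + 1 := by
          rw [hs.mem _ (by omega) (by omega)]
          simp [h1, h2, h10', h12]
        have hrem : W' (r + 23) = l.length := by
          rw [hs.mem _ (by omega) (by omega)]
          simp [h1, h2, h10', h13]
        have htop : W' (r + 24) = W 14 := by
          rw [hs.mem _ (by omega) (by omega)]
          simp [h1, h2, h10']
        have g1 := (hregs 1 (by simp)).trans h1
        have g2 := (hregs 2 (by simp)).trans h2
        -- The child has left register `14` at this record; popping restores the saved position,
        -- count and previous top.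
        refine .jz_ne rfl (by simp [hp]) (.move rfl (.add rfl (.load rfl (.add rfl (.load rfl
          (.add rfl (.load rfl (.jmp rfl (ih (a := a + 1) hl' (fun e he => hv e (by simp [he]))
          ⟨?_, ?_, ?_⟩ ?_ ?_ ?_ ?_ ?_ ?_ ?_ ?_ ?_)))))))))
        · simp [g1]
        · simp [g2]
        · simp [hregs 5, h5]
        · simp [hregs 8, h8]
        · simp [h9']
        · simp [hp]; omega
        · simp [hp, g2, hptr]
        · simp [hp, g1, g2, hrem]
        · intro i hi
          have := ha (i + 1) (by simpa using hi)
          rw [← Nat.add_assoc, Nat.add_right_comm _ i 1] at this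
          simpa using this
        · refine hpre.congr fun b h h' => ?_
          have : b ≠ 10 ∧ b ≠ 12 ∧ b ≠ 13 ∧ b ≠ 14 ∧ b ≠ 15 := by omega
          simp [this, hmem b h (by omega)]
        · omega
        · intro W'' out'' d'' hs' h9'' hd''
          refine H _ _ _ ⟨fun b hb => ?_, fun b h h' => ?_, ?_⟩ h9'' hd''
          · have : b ≠ 10 ∧ b ≠ 12 ∧ b ≠ 13 ∧ b ≠ 14 ∧ b ≠ 15 := by omega
            simp [hs'.regs b hb, this, hregs b hb]
          · have : b ≠ 10 ∧ b ≠ 12 ∧ b ≠ 13 ∧ b ≠ 14 ∧ b ≠ 15 := by omega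
            rw [hs'.mem b h h']
            simp [this, hmem b h (by omega)]
          · rw [hs'.top]
            simp [hp, g1, g2, htop]

/-- A leaf prints nothing further and must return with a small clock, hence `hd'`: its own path has
to have been printed just before. -/
theorem delivers_expand (hv : ∀ e ∈ outEdges inp u, VisitCorrect m inp n (inp (e + 2)))
    (hW : ConstRegs W) (h8 : W 8 = x) (h9 : W 9 = f.toNat) (h10 : W 10 = 20 + 5 * pre.length)
    (h11 : W 11 = u) (hpre : StoresPath W 20 x pre) (hd : d ≤ 30 * pre.length + 39)
    (hd' : outEdges inp u = [] → d = 0)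
    (H : Resumes m inp (20 + 5 * pre.length) W
      (flagAfter m f (extend x pre (pathsAlong inp n (outEdges inp u)))) cs) :
    (enumProgram m).Delivers inp 100 d ⟨39, W, out⟩
      (chunks m f (extend x pre (pathsAlong inp n (outEdges inp u))) ++ cs) := by
  have h2 := hW.two
  have hsame : ∀ p, SameBelow p W (Function.update (Function.update (Function.update W 15
      (W 11 + W 2)) 12 (inp (u + 2))) 13 (inp (inp (u + 2)))) := fun p => by
    refine ⟨fun a ha => ?_, fun a h h' => ?_, ?_⟩
    · have : a ≠ 12 ∧ a ≠ 13 ∧ a ≠ 15 := by omega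
      simp [this]
    · have : a ≠ 12 ∧ a ≠ 13 ∧ a ≠ 15 := by omega
      simp [this]
    · simp
  refine .add rfl (.read rfl (.read rfl ?_))
  simp only [Function.update_self, h11, h2] at hsame ⊢
  by_cases hE : outEdges inp u = []
  · have : inp (inp (u + 2)) = 0 := by simpa [outEdges, arrayAt] using hE
    rw [hE] at H ⊢
    refine .jz_zero rfl (by simp [this]) (H _ _ _ (hsame _) (by simp [h9, flagAfter, extend,
      pathsAlong]) ?_)
    have := hd' hE
    omega
  · have : inp (inp (u + 2)) ≠ 0 := by simpa [outEdges, arrayAt] using hE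
    refine .jz_ne rfl (by simp [this]) (delivers_nextEdge (a := inp (u + 2)) hE hv
      ((hsame 0).constRegs hW) ?_ ?_ ?_ ?_ ?_ ?_ ?_ (by omega) ?_)
    · simp [h8]
    · simp [h9]
    · simp [h10]
    · simp
    · simp [outEdges, arrayAt]
    · simp [outEdges, arrayAt]
    · exact hpre.congr fun b h h' => by
        have : b ≠ 12 ∧ b ≠ 13 ∧ b ≠ 15 := by omega
        simp [this]
    · exact fun W' out' d' hs => H _ _ _ ((hsame _).trans hs le_rfl)

/-- A non-target has an outgoing edge, so it can pass its elapsed time on to a child one level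
deeper. At a target, printing resets the clock to `0`, as a leaf requires. -/
theorem visitCorrect (hu : Productive inp n u) : VisitCorrect m inp n u := by
  induction n generalizing u with
  | zero => exact hu.elim
  | succ n ih =>
    intro W out d x pre f cs hW h8 h9 h10 h11 hlast hpre hd H
    have hsplit : extend x pre (pathsFrom inp (n + 1) u) =
        extend x pre (if inp (u + 1) = 0 then [] else [[]]) ++
          extend x pre (pathsAlong inp n (outEdges inp u)) := by
      simp [extend, pathsFrom, pathsAlong]
    rw [hsplit, flagAfter_append] at H
    rw [hsplit, chunks_append, List.append_assoc]
    have h1 := hW.one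
    obtain ⟨r, hr⟩ : ∃ r, r = 5 * pre.length := ⟨_, rfl⟩
    have h10' : W 10 = r + 20 := by omega
    -- `V` stands for the memory after the first five instructions, of which only these values
    -- matter.
    suffices key : ∀ V out, (∀ a, a ≠ 15 → a ≠ 16 → a ≠ r + 21 → V a = W a) →
        V 15 = inp (u + 1) → V 16 = inp u → V (r + 21) = inp u →
        (enumProgram m).Delivers inp 100 (d + 5) ⟨23, V, out⟩
          (chunks m f (extend x pre (if inp (u + 1) = 0 then [] else [[]])) ++
            (chunks m (flagAfter m f (extend x pre (if inp (u + 1) = 0 then [] else [[]])))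
              (extend x pre (pathsAlong inp n (outEdges inp u))) ++ cs)) by
      refine .read rfl (.add rfl (.store rfl (.add rfl (.read rfl (key _ _ ?_ ?_ ?_ ?_)))))
      · intro a ha ha' ha''
        simp [h1, h10', ha, ha', ha'']
      · simp [h1, h10', h11]
      · simp [h1, h10', h11]
      · simp [h1, h10', h11]
    intro V out hV hV15 hV16 hVr
    have hVW : ConstRegs V := ⟨by rw [hV _ (by simp) (by simp) (by omega), h1],
      by rw [hV _ (by simp) (by simp) (by omega), hW.two],
      by rw [hV _ (by simp) (by simp) (by omega), hW.five]⟩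
    have hVpre : StoresPath V 20 x pre := hpre.congr fun a h h' => by
      by_cases ha : a = r + 21
      · rw [ha, hVr, ← hr, Nat.add_comm, Function.update_self]
      · rw [hV a (by omega) (by omega) ha, Function.update_of_ne (by omega)]
    have hVsame : SameBelow (20 + 5 * pre.length) W V :=
      ⟨fun a ha => hV a (by omega) (by omega) (by omega),
        fun a h h' => hV a (by omega) (by omega) (by omega),
        hV _ (by simp) (by simp) (by omega)⟩
    have hV9 : V 9 = f.toNat := by rw [hV _ (by simp) (by simp) (by omega), h9]
    have hV8 : V 8 = x := by rw [hV _ (by simp) (by simp) (by omega), h8]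
    have hV10 : V 10 = 20 + 5 * pre.length := by rw [hV _ (by simp) (by simp) (by omega), h10]
    have hV11 : V 11 = u := by rw [hV _ (by simp) (by simp) (by omega), h11]
    have ih' := fun e he => ih (hu.2 e he)
    by_cases hT : inp (u + 1) = 0
    · simp only [hT, if_true] at H ⊢
      refine .jz_zero rfl (hV15.trans hT) (delivers_expand ih' hVW hV8 hV9 hV10 hV11 hVpre (by omega)
        (fun h => absurd hT (hu.1 h)) fun W' out' d' hs => H _ _ _ (hVsame.trans hs le_rfl))
    · simp only [hT, if_false] at H ⊢
      refine .jz_ne rfl (by rwa [hV15]) ?_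
      have hex : extend x pre [[]] = [(x, pre)] := by simp [extend]
      rw [hex] at H ⊢
      refine delivers_print hVW hV8 hV9 (hV16.trans hlast.symm) hV10 hVpre
        (by dsimp only; omega) ?_
      intro W' out' hW' hW'9
      have hVsame' : SameBelow (20 + 5 * pre.length) V W' :=
        ⟨fun a ha => hW' a (by omega) (by omega), fun a h h' => hW' a (by omega) (by omega),
          hW' _ (by simp) (by simp)⟩
      refine delivers_expand ih' (hVsame'.constRegs hVW) ?_ hW'9 ?_ ?_ ?_ (by omega)
        (fun _ => rfl) fun W'' out'' d' hs => H _ _ _ ((hVsame.trans hVsame' le_rfl).trans hs le_rfl)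
      · rw [hW' _ (by simp) (by simp), hV8]
      · rw [hW' _ (by simp) (by simp), hV10]
      · rw [hW' _ (by simp) (by simp), hV11]
      · exact hVpre.congr fun a h h' => hW' a (by omega) (by omega)

/-- Each search starts with an empty stack, `W 14 = 0`, so the backtracking of its root returns to
this loop. The bound 21 covers an empty list of sources, the only case where nothing is printed. -/
theorem delivers_sources {a : ℕ} {l : List ℕ} (hl : ∀ u ∈ l, Productive inp n u)
    (hW : ConstRegs W) (h6 : W 6 = a) (h7 : W 7 = l.length) (h9 : W 9 = f.toNat) (h14 : W 14 = 0)
    (ha : ∀ i (hi : i < l.length), inp (a + 1 + i) = l[i]) (hd : d ≤ 20)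
    (H : ∀ W' out' d', (∀ a ≤ 5, W' a = W a) → W' 14 = 0 → d' ≤ 21 →
      (enumProgram m).Delivers inp 100 d' ⟨69, W', out'⟩ cs) :
    (enumProgram m).Delivers inp 100 d ⟨12, W, out⟩
      (chunks m f (l.flatMap fun u => (pathsFrom inp n u).map fun s => (inp u, s)) ++ cs) := by
  induction l generalizing W d f a out with
  | nil => exact .jz_zero rfl h7 (H _ _ _ (fun _ _ => rfl) h14 (by omega))
  | cons u l ih =>
    have hu : inp (a + 1) = u := ha 0 (by simp)
    have h1 := hW.one
    simp only [List.length_cons] at h7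
    rw [List.flatMap_cons, chunks_append, List.append_assoc]
    refine .jz_ne rfl (by omega) (.sub rfl (.add rfl (.read rfl (.read rfl (.set rfl
      (visitCorrect (hl u (by simp)) _ _ _ _ [] _ _ ⟨?_, ?_, ?_⟩ ?_ ?_ ?_ ?_ ?_ ?_ ?_ ?_))))))
    · simp [h1]
    · simp [hW.two]
    · simp [hW.five]
    · simp [h1, h6, hu]
    · simp [h9]
    · simp
    · simp [h1, h6, hu]
    · simp [lastNode]
    · simp [StoresPath, h1, h6, hu]
    · simp; omega
    · intro W' out' d' hs h9' hd'
      simp only [List.length_nil] at hs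
      refine .jz_zero rfl (by simp [hs.top, h14]) (ih (a := a + 1)
        (fun v hv => hl v (by simp [hv])) ⟨?_, ?_, ?_⟩ ?_ ?_ ?_ ?_ ?_ (by omega) ?_)
      · simp [hs.regs, h1]
      · simp [hs.regs, hW.two]
      · simp [hs.regs, hW.five]
      · simp [hs.regs, h6, h1]
      · simp [hs.regs, h7, h1]
      · simpa [h1, h6, hu, extend] using h9'
      · simp [hs.top, h14]
      · intro i hi
        have := ha (i + 1) (by simpa using hi)
        rw [← Nat.add_assoc, Nat.add_right_comm _ i 1] at this
        simpa using this
      · intro W'' out'' d'' hs'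
        refine H _ _ _ fun b hb => ?_
        have : b ≠ 6 ∧ b ≠ 7 ∧ b ≠ 8 ∧ b ≠ 10 ∧ b ≠ 11 := by omega
        simp [hs' b hb, hs.regs b (by omega), this]

theorem delivers_pmr {a : ℕ} (ha : ∀ u ∈ arrayAt inp (inp (a + 1)), Productive inp n u)
    (hW : ConstRegs W) (h15 : W 15 = a) (h14 : W 14 = 0) (hd : d ≤ 16)
    (H : ∀ W' out' d', (∀ a ≤ 5, W' a = W a) → W' 14 = 0 → d' ≤ 21 →
      (enumProgram m).Delivers inp 100 d' ⟨69, W', out'⟩ cs) :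
    (enumProgram m).Delivers inp 100 d ⟨8, W, out⟩
      (chunks m true (pathsOfPMR inp n a) ++ cs) := by
  have h1 := hW.one
  refine .add rfl (.read rfl (.read rfl (.set rfl (delivers_sources (a := inp (a + 1)) ha
    ⟨?_, ?_, ?_⟩ ?_ ?_ ?_ ?_ ?_ (by omega) ?_))))
  · simp [h1]
  · simp [hW.two]
  · simp [hW.five]
  · simp [h15, h1]
  · simp [h15, h1, arrayAt]
  · simp
  · simp [h14]
  · simp [arrayAt]
  · intro W' out' d' hs
    refine H _ _ _ fun b hb => ?_
    have : b ≠ 6 ∧ b ≠ 7 ∧ b ≠ 9 ∧ b ≠ 15 := by omega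
    simp [hs b hb, this]

theorem delivers_single (hm : m.grouped = false)
    (h : ∀ u ∈ arrayAt inp (inp 1), Productive inp n u) :
    (enumProgram m).Delivers inp 100 0 ((enumProgram m).run inp 0)
      (chunks m true (pathsOfPMR inp n 0)) := by
  obtain ⟨g, b, c, e⟩ := m
  subst hm
  rw [← List.append_nil (chunks _ _ _)]
  refine .set rfl (.set rfl (.set rfl (.set rfl (.jz_ne rfl (by simp) (.sub rfl (.add rfl (.set rfl
    (delivers_pmr (a := 0) h ⟨?_, ?_, ?_⟩ ?_ ?_ (by omega) ?_))))))))
  · simp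
  · simp
  · simp
  · simp
  · simp
  · intro W' out' d' hs h14 hd'
    refine .set rfl (.jmp rfl (.jz_zero rfl ?_ (.halt (by simp [enumProgram]) (by omega))))
    simp [hs 4]

/-- The length bound `N` may vary with the part. The closing `done` is a chunk of its own, of weight
1. -/
theorem delivers_parts {β : Type*} {a : ℕ} {l : List β} {addr N : β → ℕ}
    (hm : m.grouped = true)
    (h : ∀ b ∈ l, ∀ u ∈ arrayAt inp (inp (addr b + 1)), Productive inp (N b) u) (hW : ConstRegs W)
    (h3 : W 3 = a) (h4 : W 4 = l.length) (h14 : W 14 = 0)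
    (ha : ∀ i (hi : i < l.length), inp (a + 1 + i) = addr l[i]) (hd : d ≤ 10) :
    (enumProgram m).Delivers inp 100 d ⟨4, W, out⟩
      (l.flatMap fun b => chunks m true (pathsOfPMR inp (N b) (addr b)) ++ [([.done], 1)]) := by
  obtain ⟨g, b₁, b₂, b₃⟩ := m
  subst hm
  induction l generalizing W d a out with
  | nil => exact .jz_zero rfl h4 (.halt (by simp [enumProgram]) (by omega))
  | cons b l ih =>
    have hb : inp (a + 1) = addr b := ha 0 (by simp)
    have h1 := hW.one
    simp only [List.length_cons] at h4
    rw [List.flatMap_cons, List.append_assoc]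
    refine .jz_ne rfl (by omega) (.sub rfl (.add rfl (.read rfl
      (delivers_pmr (h b (by simp)) ⟨?_, ?_, ?_⟩ ?_ ?_ (by omega) ?_))))
    · simp [h1]
    · simp [hW.two]
    · simp [hW.five]
    · simp [h1, h3, hb]
    · simp [h14]
    · intro W' out' d' hs h14' hd'
      refine .emitDone rfl (by omega) (.jmp rfl (ih (a := a + 1) (fun v hv => h v (by simp [hv]))
        ⟨?_, ?_, ?_⟩ ?_ ?_ h14' ?_ (by omega)))
      · simp [hs, h1]
      · simp [hs, hW.two]
      · simp [hs, hW.five]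
      · simp [hs, h1, h3]
      · simp [hs, h1, h4]
      · intro i hi
        have := ha (i + 1) (by simpa using hi)
        rw [← Nat.add_assoc, Nat.add_right_comm _ i 1] at this
        simpa using this

theorem delivers_grouped {β : Type*} {l : List β} {addr N : β → ℕ} (hm : m.grouped = true)
    (hl : StoresArray inp 0 (l.map addr))
    (h : ∀ b ∈ l, ∀ u ∈ arrayAt inp (inp (addr b + 1)), Productive inp (N b) u) :
    (enumProgram m).Delivers inp 100 0 ((enumProgram m).run inp 0)
      (l.flatMap fun b => chunks m true (pathsOfPMR inp (N b) (addr b)) ++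
        [([.done], 1)]) := by
  have hm' := hm
  obtain ⟨g, b₁, b₂, b₃⟩ := m
  subst hm
  refine .set rfl (.set rfl (.set rfl (.read rfl (delivers_parts (a := 0) hm' h ⟨?_, ?_, ?_⟩ ?_ ?_
    ?_ ?_ (by omega)))))
  · simp
  · simp
  · simp
  · simp
  · simpa using hl.1
  · simp
  · intro i hi
    rw [hl.2 i (by simpa using hi), List.getElem_map]

end Verification

/-! ## The paths of a stored PMR -/

theorem StoresArray.arrayAt_eq {inp : ℕ → ℕ} {a : ℕ} {l : List ℕ} (h : StoresArray inp a l) :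
    arrayAt inp a = l :=
  List.ext_getElem (by simp [arrayAt, h.1]) fun i _ hi => by simp [arrayAt, h.2 i hi]

/-- The identifiers on a path. -/
def UGraph.Path.code {g : UGraph} (ρ : g.Path) : ℕ × List (ℕ × ℕ) :=
  (ρ.start.1.code, ρ.steps.map fun y => (y.1.1.code, y.2.1.code))

theorem UGraph.Path.tgt_eq {g : UGraph} (ρ : g.Path) :
    ρ.tgt = lastNode ρ.start ρ.steps := by
  obtain ⟨v, s, h⟩ := ρ
  simp only [tgt, nodes]
  induction s generalizing v with
  | nil => rfl
  | cons y s ih => simpa [lastNode] using ih y.2 h.2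

theorem UGraph.Path.codeTokens_code {g : UGraph} (ρ : g.Path) :
    codeTokens ρ.code.1 ρ.code.2 = ρ.tokens := by
  simp [codeTokens, code, tokens, List.flatMap_map]

theorem UGraph.Path.lastNode_code {g : UGraph} (ρ : g.Path) :
    lastNode ρ.code.1 ρ.code.2 = ρ.tgt.1.code := by
  rw [tgt_eq]
  obtain ⟨v, s, h⟩ := ρ
  simp only [code]
  induction s generalizing v with
  | nil => rfl
  | cons y s ih => exact ih y.2 h.2

namespace PMR

variable {G : GraphDB} {R : PMR G} {inp : ℕ → ℕ} {n : ℕ} {adj : R.N → List R.E}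

open scoped Classical in
/-- The walks with fewer than `n` edges from `u` to a target node, if `adj` gives the lists of
outgoing edges. -/
noncomputable def walks (R : PMR G) (adj : R.N → List R.E) : ℕ → R.N → List (List (R.E × R.N))
  | 0, _ => []
  | n + 1, u => (if u ∈ R.T then [[]] else []) ++
      (adj u).flatMap fun e => (R.walks adj n (R.η e).2).map ((e, (R.η e).2) :: ·)

theorem mem_walks (hadj : ∀ u, IsListing (adj u) {e | (R.η e).1 = u}) {u : R.N}
    {s : List (R.E × R.N)} : s ∈ R.walks adj n u ↔
      R.toUGraph.IsWalk u s ∧ s.length < n ∧ lastNode u s ∈ R.T := by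
  induction n generalizing u s with
  | zero => simp [walks]
  | succ n ih =>
    cases s with
    | nil => by_cases h : u ∈ R.T <;> simp [walks, UGraph.IsWalk, lastNode, h]
    | cons y s =>
      obtain ⟨e, v⟩ := y
      have hs : ∀ p : Prop, ∀ _ : Decidable p,
          (e, v) :: s ∉ (if p then [[]] else [] : List (List (R.E × R.N))) := by
        intro p _
        split_ifs <;> simp
      simp only [walks, lastNode, List.mem_append, hs, false_or, List.mem_flatMap, (hadj u).2, ih,
        List.mem_map, UGraph.IsWalk, Set.mem_ofPred_eq, List.cons.injEq, Prod.mk.injEq]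
      constructor
      · rintro ⟨e, rfl, s, ⟨h1, h2, h3⟩, ⟨rfl, rfl⟩, rfl⟩
        exact ⟨⟨rfl, h1⟩, by simpa using h2, h3⟩
      · rintro ⟨⟨h1, h2⟩, h3, h4⟩
        refine ⟨e, by rw [h1], s, ⟨?_, by simpa using h3, ?_⟩, ⟨rfl, by rw [h1]⟩, rfl⟩
        · rwa [h1]
        · rwa [h1]

/-- Walks are told apart by their edges in `R`, before `γ` is applied; distinct walks with the same
image therefore contribute separately to the multiplicity. -/
theorem nodup_walks (hadj : ∀ u, IsListing (adj u) {e | (R.η e).1 = u}) (u : R.N) :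
    (R.walks adj n u).Nodup := by
  induction n generalizing u with
  | zero => simp [walks]
  | succ n ih =>
    refine List.Nodup.append (by split_ifs <;> simp) ?_ ?_
    · rw [List.nodup_flatMap]
      refine ⟨fun e _ => (ih _).map (List.cons_injective), ?_⟩
      refine (hadj u).1.imp fun {e e'} hne => ?_
      simp only [Function.onFun, List.disjoint_left, List.mem_map]
      rintro _ ⟨s, -, rfl⟩ ⟨s', -, h⟩
      simp only [List.cons.injEq, Prod.mk.injEq] at h
      exact hne h.1.1.symm
    · intro s h1 h2
      have : s = [] := by split_ifs at h1 <;> simp_all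
      subst this
      simp at h2

section Memory

variable {nodeAddr : R.N → ℕ} {edgeAddr : R.E → ℕ}

theorem pathsFrom_eq
    (hnode : ∀ u, inp (nodeAddr u) = (R.γN u).1.code ∧ inp (nodeAddr u + 1) = flag (u ∈ R.T) ∧
      outEdges inp (nodeAddr u) = (adj u).map edgeAddr)
    (hedge : ∀ e, inp (edgeAddr e) = (R.γE e).1.code ∧
      inp (edgeAddr e + 2) = nodeAddr (R.η e).2) (u : R.N) :
    pathsFrom inp n (nodeAddr u) = (R.walks adj n u).map fun s =>
      s.map fun y => ((R.γE y.1).1.code, (R.γN y.2).1.code) := by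
  induction n generalizing u with
  | zero => rfl
  | succ n ih =>
    simp only [pathsFrom, walks, List.map_append, (hnode _).2.1, (hnode _).2.2, List.flatMap_map,
      List.map_flatMap, (hedge _).1, (hedge _).2, ih, List.map_map, (hnode _).1]
    congr 1
    · by_cases h : u ∈ R.T <;> simp [flag, h]

/-- A node without outgoing edges can reach a target only by the empty walk, so it is one. The bound
drops by one at a child because walks from the child extend backwards along the edge. -/
theorem productive
    (hnode : ∀ u, inp (nodeAddr u) = (R.γN u).1.code ∧ inp (nodeAddr u + 1) = flag (u ∈ R.T) ∧
      outEdges inp (nodeAddr u) = (adj u).map edgeAddr)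
    (hedge : ∀ e, inp (edgeAddr e) = (R.γE e).1.code ∧
      inp (edgeAddr e + 2) = nodeAddr (R.η e).2)
    (hadj : ∀ u, IsListing (adj u) {e | (R.η e).1 = u})
    (htgt : ∀ u, ∃ s, R.toUGraph.IsWalk u s ∧ lastNode u s ∈ R.T) (u : R.N)
    (hn : ∀ s, R.toUGraph.IsWalk u s → s.length < n) : Productive inp n (nodeAddr u) := by
  induction n generalizing u with
  | zero => exact absurd (hn [] trivial) (by simp)
  | succ n ih =>
    rw [Productive, (hnode u).2.2, (hnode u).2.1]
    constructor
    · intro h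
      rw [List.map_eq_nil_iff] at h
      obtain ⟨_ | ⟨⟨e, v⟩, s⟩, h1, h2⟩ := htgt u
      · have : u ∈ R.T := h2
        simp [flag, this]
      · have := ((hadj u).2 e).2 (by simp [h1.1])
        simp [h] at this
    · simp only [List.mem_map, forall_exists_index, and_imp, forall_apply_eq_imp_iff₂]
      intro e he
      rw [(hedge e).2]
      refine ih _ fun s hs => ?_
      have := hn ((e, (R.η e).2) :: s) ⟨Prod.ext (((hadj u).2 e).1 he) rfl, hs⟩
      simpa using this

end Memory

/-! ### Trimness and finiteness -/

theorem isWalk_append {g : UGraph} {u : g.N} {s s' : List (g.E × g.N)} :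
    g.IsWalk u (s ++ s') ↔ g.IsWalk u s ∧ g.IsWalk (lastNode u s) s' := by
  induction s generalizing u with
  | nil => simp [UGraph.IsWalk, lastNode]
  | cons y s ih => simp [UGraph.IsWalk, lastNode, ih, and_assoc]

/-- Every node of a trim PMR is reachable from a source and reaches a target. -/
theorem Trim.exists_walks (h : R.Trim) (u : R.N) :
    (∃ v ∈ R.S, ∃ s, R.toUGraph.IsWalk v s ∧ lastNode v s = u) ∧
      ∃ s, R.toUGraph.IsWalk u s ∧ lastNode u s ∈ R.T := by
  obtain ⟨⟨v, s, hs⟩, ⟨h1, h2⟩, h3⟩ := h u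
  replace h2 : lastNode v s ∈ R.T := by rwa [UGraph.Path.tgt_eq] at h2
  simp only [UGraph.Path.nodes, List.mem_cons, List.mem_map] at h3
  rcases h3 with rfl | ⟨⟨e, w⟩, h3, rfl⟩
  · exact ⟨⟨u, h1, [], trivial, rfl⟩, s, hs, h2⟩
  · obtain ⟨s₁, s₂, rfl⟩ := List.append_of_mem h3
    rw [← List.singleton_append, ← List.append_assoc] at hs h2
    simp only [isWalk_append] at hs
    refine ⟨⟨v, h1, s₁ ++ [(e, w)], isWalk_append.2 hs.1, ?_⟩, s₂, ?_, ?_⟩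
    · simp [lastNode_append, lastNode]
    · simpa [lastNode_append, lastNode] using hs.2
    · simpa [lastNode_append, lastNode] using h2

/-- By trimness any walk extends at both ends to a path from `S` to `T`, and the finitely many such
paths have bounded length. -/
theorem exists_bound (h : R.Trim) (hfin : {π : R.toUGraph.Path | π.FromTo R.S R.T}.Finite) :
    ∃ n, ∀ u s, R.toUGraph.IsWalk u s → s.length < n := by
  obtain ⟨n, hn⟩ := (hfin.image fun π => π.steps.length).bddAbove
  refine ⟨n + 1, fun u s hs => ?_⟩
  obtain ⟨⟨v, hv, s₁, h1, rfl⟩, -⟩ := h.exists_walks u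
  obtain ⟨-, s₂, h2, h3⟩ := h.exists_walks
    (lastNode (lastNode v s₁) s)
  have hw : R.toUGraph.IsWalk v (s₁ ++ s ++ s₂) := by
    rw [isWalk_append, isWalk_append]
    exact ⟨⟨h1, hs⟩, by simpa [lastNode_append] using h2⟩
  have := hn ⟨⟨v, _, hw⟩, ⟨hv, by
    rw [UGraph.Path.tgt_eq]
    simpa [lastNode_append] using h3⟩, rfl⟩
  simp at this
  omega

open scoped Classical in
theorem mult_map_eq_mpaths {l : List R.toUGraph.Path} (hl : l.Nodup)
    (h : ∀ π, π ∈ l ↔ π.FromTo R.S R.T) :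
    Multiset.mult (l.map R.mapPath : Multiset G.toUGraph.Path) = R.mpaths := by
  funext ρ
  have : {π : R.toUGraph.Path | π.FromTo R.S R.T ∧ R.mapPath π = ρ} =
      ((l.filter fun π => R.mapPath π = ρ).toFinset : Set R.toUGraph.Path) := by
    ext π
    simp [h]
  rw [mpaths, this, Set.encard_coe_eq_coe_finsetCard, List.toFinset_card_of_nodup (hl.filter _),
    Multiset.mult, Multiset.coe_count, List.count, List.countP_map, List.countP_eq_length_filter]
  congr 3

/-- The paths from `S` to `T` split into the fibres of `γ`. Fibres outside `M` are empty, and those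
over the finitely many elements of `M` have finite cardinality. -/
theorem finite_of_mpaths_eq {M : Multiset G.toUGraph.Path} (h : R.mpaths = M.mult) :
    {π : R.toUGraph.Path | π.FromTo R.S R.T}.Finite := by
  classical
  have : {π : R.toUGraph.Path | π.FromTo R.S R.T} =
      ⋃ ρ ∈ M.toFinset, {π | π.FromTo R.S R.T ∧ R.mapPath π = ρ} := by
    ext π
    simp only [Set.mem_ofPred_eq, Set.mem_iUnion, exists_and_left, exists_prop, Multiset.mem_toFinset]
    refine ⟨fun hπ => ⟨hπ, R.mapPath π, ?_, rfl⟩, fun hπ => hπ.1⟩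
    by_contra hM
    have h0 := congrFun h (R.mapPath π)
    rw [Multiset.mult, Multiset.count_eq_zero_of_notMem hM, mpaths, Nat.cast_zero,
      Set.encard_eq_zero] at h0
    exact Set.eq_empty_iff_forall_notMem.1 h0 π ⟨hπ, rfl⟩
  rw [this]
  refine M.toFinset.finite_toSet.biUnion fun ρ _ => ?_
  rw [← Set.encard_lt_top_iff]
  exact (congrFun h ρ).trans_lt (ENat.natCast_lt_top _)

/-- The paths in the order in which they are listed by `pathsOfPMR`. -/
theorem exists_paths {a : ℕ} (h : R.Trim) {M : Multiset G.toUGraph.Path} (hM : R.mpaths = M.mult)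
    (hst : R.StoredAt inp a) : ∃ (n : ℕ) (l : List G.toUGraph.Path),
      (∀ u ∈ arrayAt inp (inp (a + 1)), Productive inp n u) ∧
      pathsOfPMR inp n a = l.map UGraph.Path.code ∧
      Multiset.mult (l : Multiset G.toUGraph.Path) = R.mpaths := by
  obtain ⟨nodeAddr, edgeAddr, -, -, -, ⟨S, hS, hSa⟩, hnode, hedge⟩ := hst
  -- One bound for all walks serves as recursion depth everywhere, so truncation at `n` loses no
  -- path.
  obtain ⟨n, hn⟩ := exists_bound h (finite_of_mpaths_eq hM)
  choose hγ hT adj hadj hadja using hnode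
  have hnode' : ∀ u, inp (nodeAddr u) = (R.γN u).1.code ∧
      inp (nodeAddr u + 1) = flag (u ∈ R.T) ∧
      outEdges inp (nodeAddr u) = (adj u).map edgeAddr :=
    fun u => ⟨hγ u, hT u, (hadja u).arrayAt_eq⟩
  have hedge' := fun e => And.intro (hedge e).1 (hedge e).2.2
  have hwalk : ∀ y ∈ S.flatMap fun u => (R.walks adj n u).map fun s => (u, s),
      R.toUGraph.IsWalk y.1 y.2 := by
    simp only [List.mem_flatMap, List.mem_map]
    rintro _ ⟨u, -, s, hs, rfl⟩
    exact ((mem_walks hadj).1 hs).1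
  let l : List R.toUGraph.Path := List.pmap (fun y hy => ⟨y.1, y.2, hy⟩) _ hwalk
  refine ⟨n, l.map R.mapPath, ?_, ?_, mult_map_eq_mpaths ?_ ?_⟩
  · rw [hSa.arrayAt_eq]
    simp only [List.mem_map, forall_exists_index, and_imp, forall_apply_eq_imp_iff₂]
    exact fun u _ => productive hnode' hedge' hadj (fun u => (h.exists_walks u).2) u (hn u)
  · rw [pathsOfPMR, hSa.arrayAt_eq]
    simp only [l, List.flatMap_map, pathsFrom_eq hnode' hedge', hγ, List.map_map, List.map_pmap]
    simp only [UGraph.Path.code, mapPath, Function.comp_def, List.map_map, Prod.map]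
    rw [List.pmap_eq_map]
    simp [List.map_flatMap, Function.comp_def]
  · refine List.Nodup.pmap (fun y _ y' _ hyy => ?_) ?_
    · simpa [Prod.ext_iff] using hyy
    · rw [List.nodup_flatMap]
      refine ⟨fun u _ => (nodup_walks hadj u).map (Prod.mk_right_injective u), ?_⟩
      refine hS.1.imp fun {u v} hne => ?_
      simp only [Function.onFun, List.disjoint_left, List.mem_map]
      rintro _ ⟨s, -, rfl⟩ ⟨s', -, h⟩
      exact hne (congrArg Prod.fst h).symm
  · rintro ⟨u, s, hs⟩
    simp only [l, List.mem_pmap, List.mem_flatMap, List.mem_map, UGraph.Path.FromTo,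
      UGraph.Path.tgt_eq, UGraph.Path.src]
    constructor
    · rintro ⟨_, ⟨v, hv, s', hs', rfl⟩, h⟩
      obtain ⟨rfl, rfl⟩ := (UGraph.Path.mk.injEq ..).mp h
      exact ⟨(hS.2 _).1 hv, ((mem_walks hadj).1 hs').2.2⟩
    · rintro ⟨h1, h2⟩
      exact ⟨(u, s), ⟨u, (hS.2 _).2 h1, s, (mem_walks hadj).2 ⟨hs, hn _ _ hs, h2⟩, rfl⟩, rfl⟩

end PMR

/-! ## The enumeration problems -/

theorem Multiset.mult_injective {α : Type*} :
    Function.Injective (Multiset.mult : Multiset α → α → ℕ∞) := by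
  classical
  intro M M' h
  ext a
  have := congrFun h a
  simp only [Multiset.mult, Nat.cast_inj] at this
  convert this

section

variable {G : GraphDB} {m : Mode} {inp : ℕ → ℕ}

theorem chunk_code (f : Bool) (ρ : G.toUGraph.Path) :
    chunk m f ρ.code.1 ρ.code.2 = ((if f then headTokens m ρ.code.1 ρ.code.2 else []) ++
      (ρ.tokens ++ [endToken m]), ρ.size) := by
  rw [chunk, UGraph.Path.codeTokens_code]
  simp [UGraph.Path.size, UGraph.Path.code]

theorem chunks_of_not_once (hm : m.once = false) (f : Bool) (l : List G.toUGraph.Path) :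
    chunks m f (l.map UGraph.Path.code) = l.flatMap fun ρ => [chunk m f ρ.code.1 ρ.code.2] := by
  induction l with
  | nil => rfl
  | cons ρ l ih =>
    simp only [List.map_cons, chunks, hm, Bool.not_false, Bool.and_true, ih]
    rfl

theorem sum_snd_chunks (f : Bool) (l : List G.toUGraph.Path) :
    ((chunks m f (l.map UGraph.Path.code)).map Prod.snd).sum =
      groupSize (l : Multiset G.toUGraph.Path) := by
  induction l generalizing f with
  | nil => rfl
  | cons ρ l ih =>
    simp [chunks, chunk_code, ih, groupSize]

theorem flatMap_fst_chunks_false (l : List G.toUGraph.Path) :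
    (chunks m false (l.map UGraph.Path.code)).flatMap Prod.fst =
      l.flatMap fun ρ => ρ.tokens ++ [endToken m] := by
  induction l with
  | nil => rfl
  | cons ρ l ih => simp [chunks, chunk_code, ih]

theorem flatMap_fst_chunks_true (hm : m.once = true) (ρ : G.toUGraph.Path)
    (l : List G.toUGraph.Path) :
    (chunks m true ((ρ :: l).map UGraph.Path.code)).flatMap Prod.fst =
      headTokens m ρ.code.1 ρ.code.2 ++ (ρ :: l).flatMap fun ρ => ρ.tokens ++ [endToken m] := by
  simp [chunks, chunk_code, hm, flatMap_fst_chunks_false]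

theorem one_le_groupSize {M : Multiset G.toUGraph.Path} (hM : M ≠ 0) : 1 ≤ groupSize M := by
  obtain ⟨ρ, hρ⟩ := Multiset.exists_mem_of_ne_zero hM
  obtain ⟨M, rfl⟩ := Multiset.exists_cons_of_mem hρ
  simp [groupSize, UGraph.Path.size]
  omega

theorem enumerates_single {α : Type*} {M : Multiset G.toUGraph.Path} {R : PMR G}
    {writes : α → List Token → Prop} {size : α → ℕ} {g : G.toUGraph.Path → α}
    (hm : m.grouped = false) (hm' : m.once = false)
    (hw : ∀ ρ, writes (g ρ) (headTokens m ρ.code.1 ρ.code.2 ++ (ρ.tokens ++ [.done])))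
    (hsize : ∀ ρ, ρ.size ≤ size (g ρ)) (hR : R.Trim) (hM : R.Represents M)
    (hst : R.StoredAt inp 0) :
    (enumProgram m).EnumeratesWithDelay inp 100 writes size (M.map g) := by
  obtain ⟨n, l, hprod, hl, hlM⟩ := PMR.exists_paths hR hM hst
  obtain rfl : (l : Multiset G.toUGraph.Path) = M := Multiset.mult_injective (hlM.trans hM)
  have H := delivers_single hm hprod
  rw [hl, chunks_of_not_once hm'] at H
  refine H.enumerates (by simp) (fun ρ _ => ?_) (fun ρ _ => ?_) le_rfl
  · simpa [chunk_code, endToken, hm] using hw ρ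
  · have := hsize ρ
    simp [chunk_code]
    omega

/-! ### Enumerating groups -/

theorem nonempty_of_mem_group {K : Set Endpoint} {M M' : Multiset G.toUGraph.Path}
    (h : M' ∈ group K M) : M' ≠ 0 := by
  classical
  simp only [group, Finset.mem_image, Multiset.mem_toFinset] at h
  obtain ⟨ρ, hρ, rfl⟩ := h
  refine fun h0 => Multiset.notMem_zero ρ (h0 ▸ ?_)
  rw [sel, Multiset.mem_filter]
  refine ⟨hρ, ?_, ?_⟩ <;> split_ifs <;> simp

theorem key_eq_of_mem_group {K : Set Endpoint} {M M' : Multiset G.toUGraph.Path}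
    (h : M' ∈ group K M) {ρ ρ' : G.toUGraph.Path} (hρ : ρ ∈ M') (hρ' : ρ' ∈ M') :
    key K ρ = key K ρ' := by
  classical
  simp only [group, Finset.mem_image, Multiset.mem_toFinset] at h
  obtain ⟨ρ₀, -, rfl⟩ := h
  rw [sel, Multiset.mem_filter] at hρ hρ'
  unfold key
  obtain ⟨-, h1, h2⟩ := hρ
  obtain ⟨-, h3, h4⟩ := hρ'
  congr 1
  · split_ifs at * <;> simp_all
  · split_ifs at * <;> simp_all

/-- Covers groups and table rows alike: `g` sends the paths of a part, in printed order, to the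
output element; `hg` says that the order is immaterial, and `π` recovers the group. -/
theorem enumerates_grouped {α : Type*} {K : Set Endpoint} {M : Multiset G.toUGraph.Path}
    {R : GroupedPMR G} {writes : α → List Token → Prop} {size : α → ℕ}
    {g : List G.toUGraph.Path → α} {O : Finset α} {π : α → Multiset G.toUGraph.Path}
    (hm : m.grouped = true) (hm' : m.once = true)
    (hπ : ∀ l, π (g l) = l)
    (hO : ∀ x, x ∈ O ↔ ∃ M' ∈ group K M, ∃ l : List G.toUGraph.Path,
      (l : Multiset G.toUGraph.Path) = M' ∧
      g l = x)
    (hg : ∀ l l' : List G.toUGraph.Path, (l : Multiset G.toUGraph.Path) ∈ group K M →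
      l.Perm l' → g l = g l')
    (hw : ∀ ρ l, writes (g (ρ :: l)) (headTokens m ρ.code.1 ρ.code.2 ++
      (((ρ :: l).flatMap fun ρ => ρ.tokens ++ [.sep]) ++ [.done])))
    (hsize : ∀ l : List G.toUGraph.Path, groupSize (l : Multiset G.toUGraph.Path) ≤ size (g l))
    (hR : R.Trim) (hM : R.Represents (group K M)) (hst : R.StoredAt inp 0) :
    (enumProgram m).EnumeratesWithDelay inp 200 writes size O.val := by
  classical
  obtain ⟨rs, hrs, hsa, hst⟩ := hst
  have hmem : ∀ x ∈ rs, x.1 ∈ R.parts := fun x hx =>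
    (hrs.2 x.1).1 (List.mem_map_of_mem hx)
  have hgroup : ∀ x ∈ rs, ∃ M' ∈ group K M, x.1.mpaths = M'.mult := fun x hx => by
    have : x.1.mpaths ∈ PMR.mpaths '' (R.parts : Set (PMR G)) := ⟨x.1, hmem x hx, rfl⟩
    rw [← hM] at this
    obtain ⟨M', h1, h2⟩ := this
    exact ⟨M', h1, h2.symm⟩
  -- The implication sits inside the existentials so that `choose` yields total functions; off `rs`
  -- their values are irrelevant.
  have hex : ∀ x : PMR G × ℕ, ∃ (n : ℕ) (l : List G.toUGraph.Path), x ∈ rs →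
      (∀ u ∈ arrayAt inp (inp (x.2 + 1)), Productive inp n u) ∧
      pathsOfPMR inp n x.2 = l.map UGraph.Path.code ∧
      Multiset.mult (l : Multiset G.toUGraph.Path) = x.1.mpaths := fun x => by
    by_cases hx : x ∈ rs
    · obtain ⟨M', -, hM'⟩ := hgroup x hx
      obtain ⟨n, l, h⟩ := PMR.exists_paths (hR x.1 (hmem x hx)) hM' (hst x hx)
      exact ⟨n, l, fun _ => h⟩
    · exact ⟨0, [], fun h => absurd h hx⟩
  choose N l hprod hl hmult using hex
  have hlgroup : ∀ x ∈ rs, (l x : Multiset _) ∈ group K M := fun x hx => by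
    obtain ⟨M', h1, h2⟩ := hgroup x hx
    rwa [Multiset.mult_injective ((hmult x hx).trans h2)]
  have hne : ∀ x ∈ rs, l x ≠ [] := fun x hx h => nonempty_of_mem_group (hlgroup x hx) (by simp [h])
  have hOeq : O.val = (rs.map fun x => g (l x) : List α) := by
    refine (Multiset.Nodup.ext O.nodup ?_).2 fun a => ?_
    · rw [Multiset.coe_nodup]
      have hpair : rs.Pairwise fun x y => x.1 ≠ y.1 := List.pairwise_map.1 hrs.1
      -- Equal outputs of distinct parts would be equal non-empty groups, giving a path common to
      -- both parts, against disjointness.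
      refine List.pairwise_map.2 (hpair.imp_of_mem fun {x y} hx hy hxy heq => ?_)
      have hxy' : (l x : Multiset G.toUGraph.Path) = l y := by rw [← hπ, ← hπ, heq]
      obtain ⟨ρ, hρ⟩ := List.exists_mem_of_ne_nil _ (hne x hx)
      have hpos : ∀ z ∈ rs, ρ ∈ l z → z.1.mpaths ρ ≠ 0 := fun z hz h => by
        rw [← hmult z hz, Multiset.mult, Ne, Nat.cast_eq_zero, Multiset.count_eq_zero]
        simpa using h
      have hρ' : ρ ∈ l y := by rwa [← Multiset.mem_coe, ← hxy', Multiset.mem_coe]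
      rcases R.disjoint _ (hmem x hx) _ (hmem y hy) hxy ρ with h | h
      · exact hpos x hx hρ h
      · exact hpos y hy hρ' h
    · rw [Finset.mem_val, hO, Multiset.mem_coe, List.mem_map]
      constructor
      · rintro ⟨_, hM', l', rfl, rfl⟩
        have : Multiset.mult (l' : Multiset G.toUGraph.Path) ∈
            Multiset.mult '' (group K M : Set (Multiset G.toUGraph.Path)) := ⟨_, hM', rfl⟩
        rw [hM] at this
        obtain ⟨R', hR', h⟩ := this
        obtain ⟨x, hx, rfl⟩ := List.mem_map.1 ((hrs.2 R').2 hR')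
        refine ⟨x, hx, hg _ _ (hlgroup x hx) ?_⟩
        exact Multiset.coe_eq_coe.1 (Multiset.mult_injective ((hmult x hx).trans h))
      · rintro ⟨x, hx, rfl⟩
        exact ⟨_, hlgroup x hx, _, rfl, rfl⟩
  have H := delivers_grouped (m := m) hm hsa hprod
  rw [hOeq]
  refine H.enumerates (by simp) (fun x hx => ?_) (fun x hx => ?_) (by simp)
  · rw [hl x hx]
    obtain ⟨ρ, l', hρ⟩ := List.exists_cons_of_ne_nil (hne x hx)
    rw [hρ, List.flatMap_append, flatMap_fst_chunks_true hm']
    simpa [endToken, hm] using hw ρ l'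
  · rw [hl x hx, List.map_append, List.sum_append, sum_snd_chunks]
    have h1 := hsize (l x)
    -- For a group of size `s ≥ 1`, the closing token raises the weight to `s + 1`, and `100 * (s +
    -- 1) ≤ 200 * s`.
    have h2 := one_le_groupSize (M := (l x : Multiset G.toUGraph.Path)) (by simpa using hne x hx)
    simp
    omega

theorem mem_groupTab {K : Set Endpoint} {M : Multiset G.toUGraph.Path}
    {x : List G.N × Multiset G.toUGraph.Path} :
    x ∈ groupTab K (group K M) ↔ x.2 ∈ group K M ∧ ∃ ρ ∈ x.2, key K ρ = x.1 := by
  classical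
  obtain ⟨k, M'⟩ := x
  simp only [groupTab, Finset.mem_biUnion, Finset.mem_image, Multiset.mem_toFinset, Prod.mk.injEq]
  constructor
  · rintro ⟨M', h, ρ, hρ, rfl, rfl⟩
    exact ⟨h, ρ, hρ, rfl⟩
  · rintro ⟨h, ρ, hρ, rfl⟩
    exact ⟨M', h, ρ, hρ, rfl, rfl⟩

end

theorem mainTheorem8 :
    -- enumeration of `M` from a trim PMR of `M`
    (∃ (P : Program) (c : ℕ), ∀ (G : GraphDB) (M : Multiset G.toUGraph.Path) (R : PMR G)
      (inp : ℕ → ℕ), R.Trim → R.Represents M → R.StoredAt inp 0 →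
        P.EnumeratesWithDelay inp c WritesPath UGraph.Path.size M) ∧
    -- enumeration of `tab(M)` from a trim PMR of `M`
    (∃ (P : Program) (c : ℕ), ∀ (G : GraphDB) (M : Multiset G.toUGraph.Path) (R : PMR G)
      (inp : ℕ → ℕ), R.Trim → R.Represents M → R.StoredAt inp 0 →
        P.EnumeratesWithDelay inp c WritesRow rowSize (tab M)) ∧
    -- for every non-empty `K ⊆ {src, tgt}`, from a trim grouped PMR of `group_K(M)`
    ∀ K : Set Endpoint, K.Nonempty →
      -- enumeration of `group_K(M)`
      (∃ (P : Program) (c : ℕ), ∀ (G : GraphDB) (M : Multiset G.toUGraph.Path)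
        (R : GroupedPMR G) (inp : ℕ → ℕ), R.Trim → R.Represents (group K M) → R.StoredAt inp 0 →
          P.EnumeratesWithDelay inp c WritesGroup groupSize (group K M).val) ∧
      -- enumeration of `tab(group_K(M))`
      (∃ (P : Program) (c : ℕ), ∀ (G : GraphDB) (M : Multiset G.toUGraph.Path)
        (R : GroupedPMR G) (inp : ℕ → ℕ), R.Trim → R.Represents (group K M) → R.StoredAt inp 0 →
          P.EnumeratesWithDelay inp c WritesGroupRow groupRowSize
            (groupTab K (group K M)).val) := by
  classical
  refine ⟨⟨enumProgram ⟨false, false, false, false⟩, 100, fun G M R inp hR hM hst => ?_⟩,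
    ⟨enumProgram ⟨false, true, true, false⟩, 100, fun G M R inp hR hM hst => ?_⟩, fun K _ =>
    ⟨⟨enumProgram ⟨true, false, false, true⟩, 200, fun G M R inp hR hM hst => ?_⟩,
    ⟨enumProgram ⟨true, decide (Endpoint.src ∈ K), decide (Endpoint.tgt ∈ K), true⟩, 200,
      fun G M R inp hR hM hst => ?_⟩⟩⟩
  · rw [← Multiset.map_id M]
    exact enumerates_single rfl rfl (fun ρ => by simp [WritesPath, headTokens]) (fun ρ => le_rfl)
      hR hM hst
  · refine enumerates_single rfl rfl (fun ρ => ?_) (fun ρ => by simp [rowSize]) hR hM hst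
    simp [WritesRow, headTokens, UGraph.Path.lastNode_code]
    rfl
  · refine enumerates_grouped (g := fun l => (l : Multiset G.toUGraph.Path)) (π := id) rfl rfl
      (fun _ => rfl) (fun M' => ?_) (fun l l' _ h => Multiset.coe_eq_coe.2 h) (fun ρ l => ?_)
      (fun l => le_rfl) hR hM hst
    · constructor
      · exact fun h => ⟨M', h, M'.toList, by simp, by simp⟩
      · rintro ⟨M', h, l, rfl, rfl⟩
        exact h
    · exact ⟨ρ :: l, rfl, by simp [headTokens]⟩
  -- The key is read off the first path, as all paths of a group share it; the default `[]` never
  -- occurs, since groups are non-empty.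
  · refine enumerates_grouped (g := fun l => ((l.head?.map (key K)).getD [],
      (l : Multiset G.toUGraph.Path)))
      (π := Prod.snd) rfl rfl (fun _ => rfl) (fun x => ?_) (fun l l' hl h => ?_) (fun ρ l => ?_)
      (fun l => by simp [groupRowSize]) hR hM hst
    · rw [mem_groupTab]
      constructor
      · rintro ⟨h, ρ, hρ, hk⟩
        obtain ⟨M', hM'⟩ := Multiset.exists_cons_of_mem hρ
        exact ⟨x.2, h, ρ :: M'.toList, by simp [← Multiset.cons_coe, hM'],
          Prod.ext (by simp [hk]) (by simp [← Multiset.cons_coe, hM'])⟩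
      · rintro ⟨_, h, l, rfl, rfl⟩
        refine ⟨h, ?_⟩
        cases l with
        | nil => exact absurd rfl (nonempty_of_mem_group h)
        | cons ρ l => exact ⟨ρ, by simp, by simp⟩
    · refine Prod.ext ?_ (Multiset.coe_eq_coe.2 h)
      cases l with
      | nil => rw [h.nil_eq]
      | cons ρ l =>
        cases l' with
        | nil => exact absurd h.length_eq (by simp)
        | cons ρ' l' =>
          simpa using key_eq_of_mem_group hl (ρ := ρ) (ρ' := ρ') (by simp)
            (by rw [Multiset.mem_coe]; exact h.mem_iff.2 (by simp))
    · refine ⟨_, ⟨ρ :: l, rfl, rfl⟩, ?_⟩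
      congr 1
      by_cases h1 : Endpoint.src ∈ K <;> by_cases h2 : Endpoint.tgt ∈ K <;>
        simp [headTokens, key, h1, h2, UGraph.Path.lastNode_code] <;> rfl
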